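/- Let $F$ be an algebraically closed field of characteristic zero and $G$ a finite group. Let $\Omega$ be the free associative $G$-graded $F$-algebra (without constant terms) on variables $x_{i,g}$ ($i\in\mathbb N$, $g\in G$), where $x_{i,g}$ has degree $g$; its elements are called graded polynomials. A graded polynomial is \emph{multilinear} if, for some finite set $V$ of variables, each of its monomials contains every variable of $V$ exactly once and no other variable; it is \emph{strongly homogeneous} if all its monomials have the same $G$-degree. A \emph{$T$-ideal} is a two-sided ideal of $\Omega$ (an $F$-subspace) closed under all $G$-graded endomorphisms of $\Omega$. A multilinear polynomial $p$ is \emph{alternating} in a set $S=\{x_{1,g},\dots,x_{m,g}\}$ of its variables of degree $g$ if $p=\sum_{\sigma\in \mathrm{Sym}(m)}\mathrm{sgn}(\sigma)\,h(x_{\sigma(1),g},\dots,x_{\sigma(m),g};Y)$ for some polynomial $h$ multilinear in the same variables, where $Y$ denotes the variables of $p$ outside $S$. Let $A=\bigoplus_{g\in G}A_g$ be a finite-dimensional associative $G$-graded $F$-algebra, not necessarily with identity, with Jacobson radical $J(A)$. Let $\mathrm{id}_G(A)\subseteq\Omega$ be its $T$-ideal of graded identities, i.e. of those graded polynomials that vanish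 under all admissible evaluations (each $x_{i,g}$ is sent into $A_g$). Write $A=\overline A\oplus J(A)$, where $\overline A=A_1\times\cdots\times A_q$ is a semisimple graded subalgebra and the $A_i$ are $G$-simple, and put $d_g=\dim_F\overline A_g=\dim_F (A/J(A))_g$ for $g\in G$. The algebra $A$ is \emph{full with respect to} a multilinear graded polynomial $f$ if there is an admissible evaluation with $f\neq0$ in which each variable of $f$ takes a value in $J(A)$ or in one of the $A_i$, and every $A_i$ contains the value of at least one variable of $f$; $A$ is \emph{full} if it is full with respect to some $f$. Assume that $A$ is \emph{subdirectly irreducible}: it has no two nonzero $G$-graded two-sided ideals with zero intersection. (1) If $A$ is full with respect to the multilinear graded polynomial $f$, then for every integer $\nu\ge0$ the $T$-ideal generated by $f$ contains a multilinear polynomial $f'\notin \mathrm{id}_G(A)$ which, for every $g\in G$, is alternating in each of $\nu$ sets of $d_g$ variables of degree $g$, all these sets being pairwise disjoint. If $f$ is strongly homogeneous, then $f'$ can be chosen strongly homogeneous. (2) Let $\mathrm{Ind}(A)_0$ be the set of all $\alpha=(\alpha_g)_{g\in G}\in\mathbb Z_{\ge0}^{G}$ such that for every integer $\nu\ge0$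 there is a multilinear strongly homogeneous graded polynomial outside $\mathrm{id}_G(A)$ which, for every $g\in G$, is alternating in each of $\nu$ sets of $\alpha_g$ variables of degree $g$, all these sets being pairwise disjoint. Let $E_0(A)$ be the set of extremal points of $\mathrm{Ind}(A)_0$, i.e. its maximal elements for the componentwise order. If $A$ is full, then $E_0(A)=\{(d_g)_{g\in G}\}$. -/

import Mathlib

/-! Graded polynomials: a pair `(g, i)` is the `i`-th variable `x_{i,g}` of degree `g`. -/

namespace GradedPI

/-- The free `G`-graded associative algebra over `F` on the variables `x_{i,g}`. It has no
constant term, so that its elements can be evaluated on algebras without identity. -/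
abbrev GPoly (F G : Type*) [Field F] : Type _ := MonoidAlgebra F (FreeSemigroup (G × ℕ))

section Polynomials

variable {F G : Type*} [Field F]

/-- The variable `x`, as a graded polynomial. -/
noncomputable def gvar (x : G × ℕ) : GPoly F G :=
  MonoidAlgebra.single (FreeSemigroup.of x) 1

/-- The evaluation of graded polynomials on an algebra `A` (not necessarily with identity)
which sends the variable `x` to `φ x`. -/
noncomputable def evalAt {A : Type*} [NonUnitalRing A] [Module F A] [IsScalarTower F A A]
    [SMulCommClass F A A] (φ : G × ℕ → A) : GPoly F G →ₙₐ[F] A :=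
  MonoidAlgebra.liftMagma F (FreeSemigroup.lift φ)

/-- The list of the variables of a monomial, in order. -/
def letters (w : FreeSemigroup (G × ℕ)) : List (G × ℕ) := w.head :: w.tail

/-- The `G`-degree of a monomial: the product of the degrees of its variables, in order. -/
def wordDegree [Group G] : FreeSemigroup (G × ℕ) →ₙ* G := FreeSemigroup.lift Prod.fst

/-- `p` is a linear combination of monomials of `G`-degree `g`. -/
def HasDegree [Group G] (p : GPoly F G) (g : G) : Prop :=
  ∀ w ∈ p.coeff.support, wordDegree w = g

/-- All the monomials of `p` have the same `G`-degree. -/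
def IsStronglyHomogeneous [Group G] (p : GPoly F G) : Prop := ∃ g, HasDegree p g

/-- `p` is multilinear in the set of variables `V`: every monomial of `p` contains each
variable of `V` exactly once, and no other variable. -/
def IsMultilinearIn (V : Finset (G × ℕ)) (p : GPoly F G) : Prop :=
  ∀ w ∈ p.coeff.support, (letters w).Nodup ∧ ∀ x, x ∈ letters w ↔ x ∈ V

/-- `p` is multilinear. -/
def IsMultilinear (p : GPoly F G) : Prop := ∃ V : Finset (G × ℕ), IsMultilinearIn V p

open Classical in
/-- The polynomial `p`, multilinear in `V`, is alternating in the set of variables `S ⊆ V`: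
it is obtained by alternating the variables of `S` in some polynomial `h` that is multilinear
in `V`. -/
def AlternatesIn (V S : Finset (G × ℕ)) (p : GPoly F G) : Prop :=
  ∃ h : GPoly F G, IsMultilinearIn V h ∧
    p = ∑ σ : Equiv.Perm S, ((Equiv.Perm.sign σ : ℤˣ) : ℤ) •
      evalAt (fun x => (gvar (Equiv.Perm.ofSubtype σ x) : GPoly F G)) h

/-- `p` is multilinear and, for every `g`, has `ν` alternating sets of `d g` variables of
degree `g`; all these sets are pairwise disjoint. -/
def IsFoldAlternating (ν : ℕ) (d : G → ℕ) (p : GPoly F G) : Prop :=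
  ∃ (V : Finset (G × ℕ)) (S : G → Fin ν → Finset (G × ℕ)),
    IsMultilinearIn V p ∧
    (∀ g j, S g j ⊆ V ∧ (∀ x ∈ S g j, x.1 = g) ∧ (S g j).card = d g) ∧
    (∀ g j j', j ≠ j' → Disjoint (S g j) (S g j')) ∧
    ∀ g j, AlternatesIn V (S g j) p

/-- `Γ` is a `T`-ideal: a two-sided ideal closed under all `G`-graded endomorphisms. -/
structure IsTIdeal [Group G] (Γ : Submodule F (GPoly F G)) : Prop where
  mul_left : ∀ p q : GPoly F G, q ∈ Γ → p * q ∈ Γ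
  mul_right : ∀ p q : GPoly F G, q ∈ Γ → q * p ∈ Γ
  endo : ∀ θ : GPoly F G →ₙₐ[F] GPoly F G, (∀ g p, HasDegree p g → HasDegree (θ p) g) →
    ∀ q ∈ Γ, θ q ∈ Γ

/-- The `T`-ideal generated by `f`. -/
noncomputable def tIdealSpan [Group G] (f : GPoly F G) : Submodule F (GPoly F G) :=
  sInf {Γ | IsTIdeal Γ ∧ f ∈ Γ}

/-- The points `α` such that for every `ν` there is a multilinear (strongly homogeneous)
graded polynomial outside `Γ` with `ν` alternating `g`-sets of cardinality `α g`, every `g`. -/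
def Ind₀ [Group G] (Γ : Submodule F (GPoly F G)) : Set (G → ℕ) :=
  {α | ∀ ν : ℕ, ∃ p : GPoly F G, p ∉ Γ ∧ IsStronglyHomogeneous p ∧ IsFoldAlternating ν α p}

/-- The extremal points of `Ind₀ Γ`. -/
def E₀ [Group G] (Γ : Submodule F (GPoly F G)) : Set (G → ℕ) :=
  {α | α ∈ Ind₀ Γ ∧ ∀ β ∈ Ind₀ Γ, α ≤ β → β = α}

end Polynomials

section Algebras

variable {F G A : Type*} [Field F] [NonUnitalRing A] [Module F A]

/-- The subspaces `𝒜 g` form a `G`-grading of the algebra `A`. -/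
structure IsGrading [Group G] (𝒜 : G → Submodule F A) : Prop where
  mul_mem : ∀ g h, ∀ a ∈ 𝒜 g, ∀ b ∈ 𝒜 h, a * b ∈ 𝒜 (g * h)
  indep : iSupIndep 𝒜
  iSup_eq_top : ⨆ g, 𝒜 g = ⊤

/-- The subspace `U` is graded, i.e. spanned by homogeneous elements. -/
def IsGradedSubspace (𝒜 : G → Submodule F A) (U : Submodule F A) : Prop :=
  U = ⨆ g, U ⊓ 𝒜 g

/-- `I ⊆ B` is a two-sided graded ideal of the graded subalgebra `B`. -/
structure IsGradedIdealOf (𝒜 : G → Submodule F A) (B I : Submodule F A) : Prop where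
  le : I ≤ B
  graded : IsGradedSubspace 𝒜 I
  mul_left : ∀ b ∈ B, ∀ a ∈ I, b * a ∈ I
  mul_right : ∀ b ∈ B, ∀ a ∈ I, a * b ∈ I

/-- No two nonzero graded ideals of `A` intersect in zero. -/
def IsSubdirectlyIrreducible (𝒜 : G → Submodule F A) : Prop :=
  ∀ I J : Submodule F A, IsGradedIdealOf 𝒜 ⊤ I → IsGradedIdealOf 𝒜 ⊤ J → I ⊓ J = ⊥ →
    I = ⊥ ∨ J = ⊥

/-- `B` is a `G`-simple graded subalgebra: its multiplication is not zero and it has no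
graded ideals other than `0` and `B`. -/
structure IsGSimple (𝒜 : G → Submodule F A) (B : Submodule F A) : Prop where
  graded : IsGradedSubspace 𝒜 B
  mul_mem : ∀ a ∈ B, ∀ b ∈ B, a * b ∈ B
  mul_ne_zero : ∃ a ∈ B, ∃ b ∈ B, a * b ≠ 0
  eq_bot_or_eq : ∀ I, IsGradedIdealOf 𝒜 B I → I = ⊥ ∨ I = B

variable [IsScalarTower F A A] [SMulCommClass F A A]

/-- The Jacobson radical `J(A)` of an algebra `A` that need not have an identity:
`J(A) = A ∩ J(A¹)`, where `A¹` is `A` with an identity adjoined. -/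
noncomputable def radical (F A : Type*) [Field F] [NonUnitalRing A] [Module F A]
    [IsScalarTower F A A] [SMulCommClass F A A] : Submodule F A :=
  ((Ring.jacobson (Unitization F A)).restrictScalars F).comap (Unitization.inrHom F F A)

/-- The dimension of the `g`-component of the semisimple algebra `A / J(A)`. -/
noncomputable def semisimpleDim (𝒜 : G → Submodule F A) (g : G) : ℕ :=
  Module.finrank F ((𝒜 g).map (radical F A).mkQ)

/-- A graded Wedderburn-Malcev decomposition `A = A₁ ⊕ ⋯ ⊕ A_q ⊕ J(A)`: the `A_i` are
`G`-simple and annihilate one another, so that `A₁ × ⋯ × A_q` is a semisimple graded subalgebra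
of `A`, which is a complement of `J(A)`. -/
structure WedderburnMalcev (𝒜 : G → Submodule F A) where
  q : ℕ
  comp : Fin q → Submodule F A
  simple : ∀ i, IsGSimple 𝒜 (comp i)
  orthogonal : ∀ i j, i ≠ j → ∀ a ∈ comp i, ∀ b ∈ comp j, a * b = 0
  indep : iSupIndep comp
  isCompl : IsCompl (⨆ i, comp i) (radical F A)

/-- An admissible evaluation: variables of degree `g` take values in `𝒜 g`. -/
def IsAdmissible (𝒜 : G → Submodule F A) (φ : G × ℕ → A) : Prop := ∀ x, φ x ∈ 𝒜 x.1

/-- The graded identities of `A`. -/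
noncomputable def gradedIdentities (𝒜 : G → Submodule F A) : Submodule F (GPoly F G) where
  carrier := {p | ∀ φ : G × ℕ → A, IsAdmissible 𝒜 φ → evalAt φ p = 0}
  add_mem' := fun hp hq φ hφ => by rw [map_add, hp φ hφ, hq φ hφ, add_zero]
  zero_mem' := fun φ _ => map_zero _
  smul_mem' := fun c p hp φ hφ => by rw [map_smul, hp φ hφ, smul_zero]

/-- `A` is full with respect to the multilinear graded polynomial `f`: some nonvanishing
admissible evaluation sends every variable of `f` to the radical or to a `G`-simple component,
every `G`-simple component being the target of some variable. -/
def IsFullWith (𝒜 : G → Submodule F A) (f : GPoly F G) : Prop :=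
  ∃ (W : WedderburnMalcev 𝒜) (V : Finset (G × ℕ)) (φ : G × ℕ → A),
    IsMultilinearIn V f ∧ IsAdmissible 𝒜 φ ∧ evalAt φ f ≠ 0 ∧
    (∀ x ∈ V, φ x ∈ radical F A ∨ ∃ i, φ x ∈ W.comp i) ∧
    ∀ i, ∃ x ∈ V, φ x ∈ W.comp i

/-- `A` is full if it is full with respect to some multilinear graded polynomial. -/
def IsFull (𝒜 : G → Submodule F A) : Prop := ∃ f : GPoly F G, IsFullWith 𝒜 f

end Algebras

end GradedPI

/-!
In characteristic zero a multilinear polynomial alternates in a set of variables as soon as it is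
skew symmetric in it: divide by the order of the symmetric group.

Choose a basis of every `(A / J(A))_g` among the homogeneous elements of the `G`-simple components.
At a nonvanishing evaluation as in the definition of fullness every component `A_i` contains the
value of some variable `u`. By Burnside's theorem on the `G`-simple `A_i`, a combination of
operators `x ↦ r * x * s`, with homogeneous `r` and `s` in `A_i`, maps a given basis element `b` to
this value and annihilates all the other basis elements of the same degree. Therefore, if `p` is
skew symmetric in variables with these other values, then for some `r` and `s` the polynomial
obtained by replacing `u` by a monomial `y z w` and alternating `z` with these variables does not
vanish for `y = r`, `z = b`, `w = s`. All the required alternating sets are filled in this way, one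
element at a time, while `y` takes over the role of `u`.

Conversely, the values of more than `d_g` variables of degree `g` are linearly dependent modulo
`J(A)`, so in an alternating set of this size one of the values may be replaced by a radical
element. With `n` such disjoint sets, where `J(A) ^ n = 0`, the polynomial is an identity. Hence
`(d_g)` is the greatest element of `Ind₀`.
-/

namespace GradedPI

open Function
open scoped Classical

section Words

variable {F G : Type*} [Field F]

/-- The words in which every variable of `V` occurs exactly once, and no other one occurs. -/
def multilinearWords (V : Finset (G × ℕ)) : Set (FreeSemigroup (G × ℕ)) :=
  {w | (letters w).Nodup ∧ ∀ x, x ∈ letters w ↔ x ∈ V}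

theorem isMultilinearIn_iff_mem_supported {V : Finset (G × ℕ)} {p : GPoly F G} :
    IsMultilinearIn V p ↔ p ∈ MonoidAlgebra.supported F F (multilinearWords V) :=
  Iff.rfl

theorem hasDegree_iff_mem_supported [Group G] {p : GPoly F G} {g : G} :
    HasDegree p g ↔ p ∈ MonoidAlgebra.supported F F {w | wordDegree w = g} :=
  Iff.rfl

theorem letters_of (x : G × ℕ) : letters (FreeSemigroup.of x) = [x] := rfl

theorem letters_mul (u v : FreeSemigroup (G × ℕ)) :
    letters (u * v) = letters u ++ letters v := rfl

theorem letters_lift (θ : G × ℕ → FreeSemigroup (G × ℕ)) (w : FreeSemigroup (G × ℕ)) :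
    letters (FreeSemigroup.lift θ w) = (letters w).flatMap fun x => letters (θ x) := by
  induction w using FreeSemigroup.recOnMul with
  | ih1 x => simp [letters_of]
  | ih2 x w _ ih => simp [letters_mul, letters_of, ih]

theorem lift_of_eq_self (w : FreeSemigroup (G × ℕ)) :
    FreeSemigroup.lift FreeSemigroup.of w = w :=
  DFunLike.congr_fun (FreeSemigroup.lift_comp_of' (MulHom.id _)) w

theorem lift_lift {M : Type*} [Semigroup M] (φ : G × ℕ → M)
    (θ : G × ℕ → FreeSemigroup (G × ℕ)) (w : FreeSemigroup (G × ℕ)) :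
    FreeSemigroup.lift φ (FreeSemigroup.lift θ w) =
      FreeSemigroup.lift (fun x => FreeSemigroup.lift φ (θ x)) w := by
  induction w using FreeSemigroup.recOnMul with
  | ih1 x => simp only [FreeSemigroup.lift_of]
  | ih2 x w _ ih => simp only [map_mul, FreeSemigroup.lift_of, ih]

theorem lift_congr {M : Type*} [Semigroup M] {φ ψ : G × ℕ → M} {w : FreeSemigroup (G × ℕ)}
    (h : ∀ x ∈ letters w, φ x = ψ x) : FreeSemigroup.lift φ w = FreeSemigroup.lift ψ w := by
  induction w using FreeSemigroup.recOnMul with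
  | ih1 x => simpa [letters_of] using h
  | ih2 x w _ ih =>
    rw [map_mul, map_mul, ih fun y hy => h y (by simp [letters_mul, hy]),
      FreeSemigroup.lift_of, FreeSemigroup.lift_of, h x (by simp [letters_mul, letters_of])]

end Words

section Evaluation

variable {F G A : Type*} [Field F] [NonUnitalRing A] [Module F A] [IsScalarTower F A A]
  [SMulCommClass F A A]

theorem evalAt_single (φ : G × ℕ → A) (w : FreeSemigroup (G × ℕ)) (c : F) :
    evalAt φ (MonoidAlgebra.single w c : GPoly F G) = c • FreeSemigroup.lift φ w := by
  simp [evalAt, MonoidAlgebra.liftMagma_apply_apply]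

theorem evalAt_eq_sum (φ : G × ℕ → A) (p : GPoly F G) :
    evalAt φ p = ∑ w ∈ p.coeff.support, p.coeff w • FreeSemigroup.lift φ w := by
  simp [evalAt, MonoidAlgebra.liftMagma_apply_apply, Finsupp.sum]

theorem evalAt_congr {V : Finset (G × ℕ)} {p : GPoly F G} (hp : IsMultilinearIn V p)
    {φ ψ : G × ℕ → A} (h : ∀ x ∈ V, φ x = ψ x) : evalAt φ p = evalAt ψ p := by
  rw [evalAt_eq_sum, evalAt_eq_sum]
  exact Finset.sum_congr rfl fun w hw =>
    congrArg _ (lift_congr fun x hx => h x (((hp w hw).2 x).1 hx))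

theorem isLinearMap_lift_update (φ : G × ℕ → A) {x : G × ℕ} {w : FreeSemigroup (G × ℕ)}
    (hw : (letters w).Nodup) (hx : x ∈ letters w) :
    IsLinearMap F fun a => FreeSemigroup.lift (update φ x a) w := by
  induction w using FreeSemigroup.recOnMul with
  | ih1 y =>
    obtain rfl : x = y := by simpa [letters_of] using hx
    exact ⟨by simp, by simp⟩
  | ih2 y w _ ih =>
    simp only [letters_mul, letters_of, List.singleton_append, List.nodup_cons,
      List.mem_cons] at hw hx
    by_cases hxy : x = y
    · subst hxy
      have hlift : ∀ a, FreeSemigroup.lift (update φ x a) w = FreeSemigroup.lift φ w := fun a =>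
        lift_congr fun z hz => update_of_ne (ne_of_mem_of_not_mem hz hw.1) _ _
      simp only [map_mul, FreeSemigroup.lift_of, update_self, hlift]
      exact (LinearMap.mulRight F (FreeSemigroup.lift φ w)).isLinear
    · have hlin := ih hw.2 (hx.resolve_left hxy)
      simp only [map_mul, FreeSemigroup.lift_of, update_of_ne (Ne.symm hxy)]
      exact (LinearMap.mulLeft F (φ y) ∘ₗ hlin.mk').isLinear

theorem IsMultilinearIn.isLinearMap_evalAt_update {V : Finset (G × ℕ)} {p : GPoly F G}
    (hp : IsMultilinearIn V p) (φ : G × ℕ → A) {x : G × ℕ} (hx : x ∈ V) :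
    IsLinearMap F fun a => evalAt (update φ x a) p := by
  have hword : ∀ w ∈ p.coeff.support,
      IsLinearMap F fun a => FreeSemigroup.lift (update φ x a) w := fun w hw =>
    isLinearMap_lift_update φ (hp w hw).1 (((hp w hw).2 x).2 hx)
  refine ⟨fun a b => ?_, fun c a => ?_⟩
  · simp only [evalAt_eq_sum, ← Finset.sum_add_distrib, ← smul_add]
    exact Finset.sum_congr rfl fun w hw => by rw [(hword w hw).map_add]
  · simp only [evalAt_eq_sum, Finset.smul_sum]
    exact Finset.sum_congr rfl fun w hw => by rw [(hword w hw).map_smul, smul_comm]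

theorem IsMultilinearIn.evalAt_eq_zero {V : Finset (G × ℕ)} {p : GPoly F G}
    (hp : IsMultilinearIn V p) {φ : G × ℕ → A} {x : G × ℕ} (hx : x ∈ V) (h : φ x = 0) :
    evalAt φ p = 0 := by
  rw [← update_eq_self x φ, h]
  exact (hp.isLinearMap_evalAt_update φ hx).map_zero

end Evaluation

section Substitution

variable {F G : Type*} [Field F]

/-- The substitution of the monomials `θ x` for the variables `x`. -/
noncomputable def subst (θ : G × ℕ → FreeSemigroup (G × ℕ)) : GPoly F G →ₙₐ[F] GPoly F G :=
  evalAt fun x => MonoidAlgebra.single (θ x) 1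

theorem subst_single (θ : G × ℕ → FreeSemigroup (G × ℕ)) (w : FreeSemigroup (G × ℕ)) (c : F) :
    subst θ (MonoidAlgebra.single w c : GPoly F G) =
      MonoidAlgebra.single (FreeSemigroup.lift θ w) c := by
  have hlift : FreeSemigroup.lift (fun x => (MonoidAlgebra.single (θ x) 1 : GPoly F G)) w =
      MonoidAlgebra.single (FreeSemigroup.lift θ w) 1 := by
    induction w using FreeSemigroup.recOnMul with
    | ih1 x => simp
    | ih2 x w _ ih => rw [map_mul, map_mul, ih]; simp [MonoidAlgebra.single_mul_single]
  rw [subst, evalAt_single, hlift, MonoidAlgebra.smul_single, smul_eq_mul, mul_one]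

theorem evalAt_subst {A : Type*} [NonUnitalRing A] [Module F A] [IsScalarTower F A A]
    [SMulCommClass F A A] (φ : G × ℕ → A) (θ : G × ℕ → FreeSemigroup (G × ℕ)) (p : GPoly F G) :
    evalAt φ (subst θ p) = evalAt (fun x => FreeSemigroup.lift φ (θ x)) p := by
  induction p using MonoidAlgebra.induction_linear with
  | zero => simp
  | add p q hp hq => rw [map_add, map_add, map_add, hp, hq]
  | single w c => rw [subst_single, evalAt_single, evalAt_single, lift_lift]

theorem subst_subst (θ θ' : G × ℕ → FreeSemigroup (G × ℕ)) (p : GPoly F G) :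
    subst θ' (subst θ p) = subst (fun x => FreeSemigroup.lift θ' (θ x)) p := by
  induction p using MonoidAlgebra.induction_linear with
  | zero => simp
  | add p q hp hq => simp only [map_add, hp, hq]
  | single w c => simp only [subst_single, lift_lift]

theorem subst_of (p : GPoly F G) : subst FreeSemigroup.of p = p := by
  induction p using MonoidAlgebra.induction_linear with
  | zero => simp
  | add p q hp hq => rw [map_add, hp, hq]
  | single w c => rw [subst_single, lift_of_eq_self]

theorem subst_congr {V : Finset (G × ℕ)} {p : GPoly F G} (hp : IsMultilinearIn V p)
    {θ θ' : G × ℕ → FreeSemigroup (G × ℕ)} (h : ∀ x ∈ V, θ x = θ' x) :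
    subst θ p = subst θ' p :=
  evalAt_congr hp fun x hx => by rw [h x hx]

theorem subst_mem_supported {P Q : Set (FreeSemigroup (G × ℕ))}
    {θ : G × ℕ → FreeSemigroup (G × ℕ)} (h : ∀ w ∈ P, FreeSemigroup.lift θ w ∈ Q)
    {p : GPoly F G} (hp : p ∈ MonoidAlgebra.supported F F P) :
    subst θ p ∈ MonoidAlgebra.supported F F Q := by
  rw [MonoidAlgebra.supported_eq_span_single] at hp ⊢
  induction hp using Submodule.span_induction with
  | mem x hx =>
    obtain ⟨w, hw, rfl⟩ := hx
    exact Submodule.subset_span ⟨_, h w hw, (subst_single θ w 1).symm⟩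
  | zero => simp
  | add p q _ _ hp hq => rw [map_add]; exact add_mem hp hq
  | smul c p _ hp => rw [map_smul]; exact Submodule.smul_mem _ c hp

theorem IsMultilinearIn.subst {V : Finset (G × ℕ)} {p : GPoly F G}
    (hp : IsMultilinearIn V p) {θ : G × ℕ → FreeSemigroup (G × ℕ)}
    (hn : ∀ x ∈ V, (letters (θ x)).Nodup)
    (hd : ∀ x ∈ V, ∀ y ∈ V, x ≠ y → (letters (θ x)).Disjoint (letters (θ y))) :
    IsMultilinearIn (V.biUnion fun x => (letters (θ x)).toFinset) (subst θ p) := by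
  refine subst_mem_supported (P := multilinearWords V) (Q := multilinearWords _)
    (fun w hw => ⟨?_, fun x => ?_⟩) hp
  · rw [letters_lift, List.nodup_flatMap]
    refine ⟨fun x hx => hn x ((hw.2 x).1 hx), hw.1.imp_of_mem fun ha hb hab => ?_⟩
    exact hd _ ((hw.2 _).1 ha) _ ((hw.2 _).1 hb) hab
  · rw [letters_lift, List.mem_flatMap]
    simp [hw.2]

variable [Group G]

theorem HasDegree.subst {p : GPoly F G} {g : G} (hp : HasDegree p g)
    {θ : G × ℕ → FreeSemigroup (G × ℕ)} (hθ : ∀ x, wordDegree (θ x) = x.1) :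
    HasDegree (subst θ p) g := by
  rw [hasDegree_iff_mem_supported] at hp ⊢
  refine subst_mem_supported (fun w (hw : wordDegree w = g) => ?_) hp
  calc wordDegree (FreeSemigroup.lift θ w)
    _ = FreeSemigroup.lift (fun x => wordDegree (θ x)) w := lift_lift _ _ _
    _ = g := by simp only [hθ]; exact hw

theorem mem_tIdealSpan_self (f : GPoly F G) : f ∈ tIdealSpan f :=
  Submodule.mem_sInf.2 fun _ h => h.2

theorem subst_mem_tIdealSpan {f q : GPoly F G} (hq : q ∈ tIdealSpan f)
    {θ : G × ℕ → FreeSemigroup (G × ℕ)} (hθ : ∀ x, wordDegree (θ x) = x.1) :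
    subst θ q ∈ tIdealSpan f :=
  Submodule.mem_sInf.2 fun Γ h => h.1.endo (subst θ) (fun _ _ hp => hp.subst hθ) q
    (Submodule.mem_sInf.1 hq Γ h)

end Substitution

section Expansion

variable {F G : Type*} [Field F] {p : GPoly F G} {V : Finset (G × ℕ)} {u : G × ℕ}
  {m : FreeSemigroup (G × ℕ)}

/-- The substitution of the monomial `m` for the single variable `u`. -/
noncomputable abbrev expand (u : G × ℕ) (m : FreeSemigroup (G × ℕ)) :
    GPoly F G →ₙₐ[F] GPoly F G :=
  subst (update FreeSemigroup.of u m)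

theorem evalAt_expand {A : Type*} [NonUnitalRing A] [Module F A] [IsScalarTower F A A]
    [SMulCommClass F A A] (φ : G × ℕ → A) :
    evalAt φ (expand u m p) = evalAt (update φ u (FreeSemigroup.lift φ m)) p := by
  rw [evalAt_subst]
  congr
  funext x
  rcases eq_or_ne x u with rfl | hx
  · rw [update_self, update_self]
  · rw [update_of_ne hx, update_of_ne hx, FreeSemigroup.lift_of]

theorem IsMultilinearIn.expand (hp : IsMultilinearIn V p) (hu : u ∈ V)
    (hm : (letters m).Nodup) (hd : ∀ x ∈ letters m, x ∉ V) :
    IsMultilinearIn (V.erase u ∪ (letters m).toFinset) (expand u m p) := by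
  have hθ : ∀ x ∈ V.erase u, update FreeSemigroup.of u m x = FreeSemigroup.of x := fun x hx =>
    update_of_ne (Finset.ne_of_mem_erase hx) _ _
  have hV : V.biUnion (fun x => (letters (update FreeSemigroup.of u m x)).toFinset) =
      V.erase u ∪ (letters m).toFinset := by
    rw [← Finset.insert_erase hu, Finset.biUnion_insert, update_self, Finset.union_comm,
      Finset.biUnion_congr rfl fun x hx => by rw [hθ x hx, letters_of], Finset.insert_erase hu]
    simp
  rw [← hV]
  refine hp.subst (fun x _ => ?_) fun x hx y hy hxy => ?_
  · rcases eq_or_ne x u with rfl | hxu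
    · rwa [update_self]
    · simp [update_of_ne hxu, letters_of]
  · rcases eq_or_ne x u with rfl | hxu
    · rw [update_self, update_of_ne hxy.symm, letters_of, List.disjoint_singleton]
      exact fun h => hd y h hy
    rcases eq_or_ne y u with rfl | hyu
    · rw [update_self, update_of_ne hxy, letters_of, List.singleton_disjoint]
      exact fun h => hd x h hx
    · simpa [update_of_ne hxu, update_of_ne hyu, letters_of] using hxy.symm

theorem wordDegree_update [Group G] (hm : wordDegree m = u.1) (x : G × ℕ) :
    wordDegree (update FreeSemigroup.of u m x) = x.1 := by
  rcases eq_or_ne x u with rfl | hx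
  · rwa [update_self]
  · rw [update_of_ne hx, wordDegree, FreeSemigroup.lift_of]

end Expansion

section Permutations

variable {F G : Type*} [Field F] {p : GPoly F G} {V S : Finset (G × ℕ)} {x y : G × ℕ}

/-- The substitution which permutes the variables. -/
noncomputable abbrev permute (σ : Equiv.Perm (G × ℕ)) : GPoly F G →ₙₐ[F] GPoly F G :=
  subst fun x => FreeSemigroup.of (σ x)

theorem permute_permute (σ τ : Equiv.Perm (G × ℕ)) (p : GPoly F G) :
    permute σ (permute τ p) = permute (σ * τ) p := by
  rw [subst_subst]
  simp only [FreeSemigroup.lift_of]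
  rfl

theorem permute_one (p : GPoly F G) : permute 1 p = p := subst_of p

theorem evalAt_permute {A : Type*} [NonUnitalRing A] [Module F A] [IsScalarTower F A A]
    [SMulCommClass F A A] (φ : G × ℕ → A) (σ : Equiv.Perm (G × ℕ)) (p : GPoly F G) :
    evalAt φ (permute σ p) = evalAt (fun x => φ (σ x)) p := by
  simp only [evalAt_subst, FreeSemigroup.lift_of]

theorem IsMultilinearIn.permute (hp : IsMultilinearIn V p) {σ : Equiv.Perm (G × ℕ)}
    (hσ : ∀ x ∈ V, σ x ∈ V) : IsMultilinearIn V (permute σ p) := by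
  have himage : (V.biUnion fun x => (letters (FreeSemigroup.of (σ x))).toFinset) = V := by
    simp only [letters_of, List.toFinset_cons, List.toFinset_nil, insert_empty_eq,
      Finset.biUnion_singleton]
    exact Finset.eq_of_subset_of_card_le (Finset.image_subset_iff.2 hσ)
      (Finset.card_image_of_injective V σ.injective).ge
  rw [← himage]
  refine hp.subst (fun x _ => List.nodup_singleton _) fun x _ y _ hxy => ?_
  simpa [letters_of] using (σ.injective.ne hxy).symm

theorem swap_mem_iff (hx : x ∈ V) (hy : y ∈ V) (z : G × ℕ) :
    Equiv.swap x y z ∈ V ↔ z ∈ V := by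
  rw [Equiv.swap_apply_def]
  split_ifs with hzx hzy
  · simp [hzx, hx, hy]
  · simp [hzy, hx, hy]
  · rfl

theorem swap_apply_of_mem_of_notMem {z : G × ℕ} (hz : z ∈ S) (hx : x ∉ S) (hy : y ∉ S) :
    Equiv.swap x y z = z :=
  Equiv.swap_apply_of_ne_of_ne (ne_of_mem_of_not_mem hz hx) (ne_of_mem_of_not_mem hz hy)

theorem swap_apply_of_mem_of_mem {z : G × ℕ} (hz : z ∉ S) (hx : x ∈ S) (hy : y ∈ S) :
    Equiv.swap x y z = z :=
  Equiv.swap_apply_of_ne_of_ne (ne_of_mem_of_not_mem hx hz).symm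
    (ne_of_mem_of_not_mem hy hz).symm

theorem wordDegree_swap [Group G] (h : x.1 = y.1) (z : G × ℕ) :
    wordDegree (FreeSemigroup.of (Equiv.swap x y z)) = z.1 := by
  rw [wordDegree, FreeSemigroup.lift_of, Equiv.swap_apply_def]
  split_ifs with hzx hzy <;> simp_all

end Permutations

section SkewSymmetry

variable {F G : Type*} [Field F] {p q : GPoly F G} {V S : Finset (G × ℕ)} {x y : G × ℕ}

/-- Transposing two variables of `S` changes the sign of `p`. In characteristic zero this is
equivalent to `p` being alternating in `S`, and it is easier to propagate. -/
def IsSkewIn (S : Finset (G × ℕ)) (p : GPoly F G) : Prop :=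
  ∀ x ∈ S, ∀ y ∈ S, x ≠ y → permute (Equiv.swap x y) p = -p

theorem IsSkewIn.sub (hp : IsSkewIn S p) (hq : IsSkewIn S q) : IsSkewIn S (p - q) :=
  fun x hx y hy hxy => by rw [map_sub, hp x hx y hy hxy, hq x hx y hy hxy, neg_sub_neg, neg_sub]

theorem IsSkewIn.sum {ι : Type*} {s : Finset ι} {p : ι → GPoly F G}
    (hp : ∀ i ∈ s, IsSkewIn S (p i)) : IsSkewIn S (∑ i ∈ s, p i) := fun x hx y hy hxy => by
  rw [map_sum, ← Finset.sum_neg_distrib]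
  exact Finset.sum_congr rfl fun i hi => hp i hi x hx y hy hxy

theorem IsSkewIn.expand (hV : IsMultilinearIn V p) (hp : IsSkewIn S p) {u : G × ℕ} (hu : u ∉ S)
    {m : FreeSemigroup (G × ℕ)} (hm : ∀ x ∈ letters m, x ∉ S) : IsSkewIn S (expand u m p) := by
  intro x hx y hy hxy
  rw [← map_neg, ← hp x hx y hy hxy, subst_subst, subst_subst]
  refine subst_congr hV fun z _ => ?_
  rw [FreeSemigroup.lift_of]
  rcases eq_or_ne z u with rfl | hzu
  · rw [swap_apply_of_mem_of_mem hu hx hy, update_self,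
      lift_congr (ψ := FreeSemigroup.of) fun v hv => ?_, lift_of_eq_self]
    rw [swap_apply_of_mem_of_mem (hm v hv) hx hy]
  · have hswap : Equiv.swap x y z ≠ u := fun h =>
      hzu ((Equiv.swap_apply_eq_iff.1 h).trans (swap_apply_of_mem_of_mem hu hx hy))
    rw [update_of_ne hzu, update_of_ne hswap, FreeSemigroup.lift_of]

theorem IsSkewIn.permute_swap (hp : IsSkewIn S p) (hx : x ∉ S) (hy : y ∉ S) :
    IsSkewIn S (permute (Equiv.swap x y) p) := by
  intro u hu v hv huv
  rw [← map_neg, ← hp u hu v hv huv, permute_permute, permute_permute,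
    Equiv.mul_swap_eq_swap_mul (Equiv.swap x y), swap_apply_of_mem_of_notMem hu hx hy,
    swap_apply_of_mem_of_notMem hv hx hy]

theorem IsSkewIn.permute_ofSubtype (hp : IsSkewIn S p) (σ : Equiv.Perm S) :
    permute (Equiv.Perm.ofSubtype σ) p = ((Equiv.Perm.sign σ : ℤˣ) : ℤ) • p := by
  induction σ using Equiv.Perm.swap_induction_on with
  | one => simp [permute_one]
  | swap_mul f x y hxy ih =>
    rw [map_mul, ← permute_permute, ih, map_zsmul, Equiv.Perm.ofSubtype_swap_eq,
      hp x.1 x.2 y.1 y.2 (fun h => hxy (Subtype.ext h)), map_mul, Equiv.Perm.sign_swap hxy]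
    simp

theorem IsSkewIn.alternatesIn [CharZero F] (hV : IsMultilinearIn V p) (hp : IsSkewIn S p) :
    AlternatesIn V S p := by
  refine ⟨(Fintype.card (Equiv.Perm S) : F)⁻¹ • p, Submodule.smul_mem _ _
    (isMultilinearIn_iff_mem_supported.1 hV), ?_⟩
  have hcard : (Fintype.card (Equiv.Perm S) : F) ≠ 0 := Nat.cast_ne_zero.2 Fintype.card_ne_zero
  calc p = ∑ _ : Equiv.Perm S, (Fintype.card (Equiv.Perm S) : F)⁻¹ • p := by
        rw [Finset.sum_const, Finset.card_univ, ← Nat.cast_smul_eq_nsmul F, smul_smul,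
          mul_inv_cancel₀ hcard, one_smul]
    _ = ∑ σ : Equiv.Perm S, ((Equiv.Perm.sign σ : ℤˣ) : ℤ) •
        permute (Equiv.Perm.ofSubtype σ) ((Fintype.card (Equiv.Perm S) : F)⁻¹ • p) := by
      refine Finset.sum_congr rfl fun _ _ => ?_
      rw [map_smul, hp.permute_ofSubtype, smul_comm, smul_smul, ← Units.val_mul,
        Int.units_mul_self, Units.val_one, one_smul]

theorem AlternatesIn.isSkewIn (hp : AlternatesIn V S p) : IsSkewIn S p := by
  obtain ⟨h, -, hp⟩ := hp
  replace hp : p = ∑ σ : Equiv.Perm S, ((Equiv.Perm.sign σ : ℤˣ) : ℤ) •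
      permute (Equiv.Perm.ofSubtype σ) h := hp
  intro x hx y hy hxy
  rw [hp, map_sum, ← Finset.sum_neg_distrib]
  refine Fintype.sum_equiv (Equiv.mulLeft (Equiv.swap ⟨x, hx⟩ ⟨y, hy⟩)) _ _ fun σ => ?_
  rw [map_zsmul, permute_permute, Equiv.coe_mulLeft, map_mul, map_mul,
    Equiv.Perm.sign_swap (fun h => hxy (congrArg Subtype.val h)), Equiv.Perm.ofSubtype_swap_eq]
  simp

theorem IsSkewIn.evalAt_eq_zero [NeZero (2 : F)] {A : Type*} [NonUnitalRing A] [Module F A]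
    [IsScalarTower F A A] [SMulCommClass F A A] (hp : IsSkewIn S p) {φ : G × ℕ → A}
    (hx : x ∈ S) (hy : y ∈ S) (hxy : x ≠ y) (h : φ x = φ y) : evalAt φ p = 0 := by
  have hφ : (fun z => φ (Equiv.swap x y z)) = φ := by
    funext z
    rw [Equiv.swap_apply_def]
    split_ifs with hzx hzy
    · rw [hzx, h]
    · rw [hzy, h]
    · rfl
  have heval := congrArg (evalAt φ) (hp x hx y hy hxy)
  rw [evalAt_permute, hφ, map_neg] at heval
  have htwo : (2 : F) • evalAt φ p = 0 := by rw [two_smul]; exact add_eq_zero_iff_eq_neg.2 heval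
  exact (smul_eq_zero.1 htwo).resolve_left two_ne_zero

end SkewSymmetry

section Alternation

variable {F G : Type*} [Field F] {p : GPoly F G} {V S T : Finset (G × ℕ)} {z : G × ℕ}

/-- One step of alternation: if `p` is skew symmetric in `S` and `z ∉ S`, this polynomial is
skew symmetric in `S ∪ {z}`. -/
noncomputable def alternateWith (z : G × ℕ) (S : Finset (G × ℕ)) (p : GPoly F G) : GPoly F G :=
  p - ∑ t ∈ S, permute (Equiv.swap z t) p

theorem evalAt_alternateWith {A : Type*} [NonUnitalRing A] [Module F A] [IsScalarTower F A A]
    [SMulCommClass F A A] (φ : G × ℕ → A) :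
    evalAt φ (alternateWith z S p) =
      evalAt φ p - ∑ t ∈ S, evalAt (fun x => φ (Equiv.swap z t x)) p := by
  simp only [alternateWith, map_sub, map_sum, evalAt_permute]

theorem IsMultilinearIn.alternateWith (hp : IsMultilinearIn V p) (hz : z ∈ V) (hS : S ⊆ V) :
    IsMultilinearIn V (alternateWith z S p) := by
  rw [isMultilinearIn_iff_mem_supported]
  exact sub_mem hp (sum_mem fun t ht =>
    hp.permute fun x hx => (swap_mem_iff hz (hS ht) x).2 hx)

theorem HasDegree.alternateWith [Group G] {g : G} (hp : HasDegree p g)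
    (hS : ∀ t ∈ S, t.1 = z.1) : HasDegree (alternateWith z S p) g := by
  rw [hasDegree_iff_mem_supported]
  exact sub_mem hp (sum_mem fun t ht => hp.subst (wordDegree_swap (hS t ht).symm))

theorem alternateWith_mem_tIdealSpan [Group G] {f : GPoly F G} (hp : p ∈ tIdealSpan f)
    (hS : ∀ t ∈ S, t.1 = z.1) : alternateWith z S p ∈ tIdealSpan f :=
  sub_mem hp (sum_mem fun t ht => subst_mem_tIdealSpan hp (wordDegree_swap (hS t ht).symm))

theorem IsSkewIn.alternateWith_of_disjoint (hp : IsSkewIn T p) (hz : z ∉ T)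
    (hS : Disjoint S T) : IsSkewIn T (alternateWith z S p) :=
  hp.sub (IsSkewIn.sum fun _ ht => hp.permute_swap hz (Finset.disjoint_left.1 hS ht))

theorem IsSkewIn.permute_swap_permute_swap (hp : IsSkewIn S p) (hz : z ∉ S) {t u : G × ℕ}
    (ht : t ∈ S) (hu : u ∈ S) (htu : t ≠ u) :
    permute (Equiv.swap z t) (permute (Equiv.swap z u) p) = -permute (Equiv.swap z u) p := by
  rw [← map_neg, ← hp u hu t ht htu.symm, permute_permute, permute_permute,
    Equiv.mul_swap_eq_swap_mul (Equiv.swap z u) u t, Equiv.swap_apply_right,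
    Equiv.swap_apply_of_ne_of_ne (ne_of_mem_of_not_mem ht hz) htu]

theorem IsSkewIn.permute_swap_alternateWith (hp : IsSkewIn S p) (hz : z ∉ S) {t : G × ℕ}
    (ht : t ∈ S) :
    permute (Equiv.swap z t) (alternateWith z S p) = -alternateWith z S p := by
  have hsum := Finset.add_sum_erase S (fun u => permute (Equiv.swap z u) p) ht
  simp only [alternateWith, ← hsum, map_sub, map_add, map_sum, permute_permute (F := F),
    Equiv.swap_mul_self, permute_one]
  simp only [← permute_permute]
  rw [Finset.sum_congr rfl fun u hu => hp.permute_swap_permute_swap hz ht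
    (Finset.mem_of_mem_erase hu) (Finset.ne_of_mem_erase hu).symm, Finset.sum_neg_distrib]
  abel

theorem IsSkewIn.alternateWith (hp : IsSkewIn S p) (hz : z ∉ S) :
    IsSkewIn (insert z S) (alternateWith z S p) := by
  intro x hx y hy hxy
  rcases Finset.mem_insert.1 hx with rfl | hxS
  · exact hp.permute_swap_alternateWith hz ((Finset.mem_insert.1 hy).resolve_left hxy.symm)
  rcases Finset.mem_insert.1 hy with rfl | hyS
  · rw [Equiv.swap_comm]
    exact hp.permute_swap_alternateWith hz hxS
  rw [GradedPI.alternateWith, map_sub, map_sum, hp x hxS y hyS hxy, neg_sub', sub_right_inj,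
    ← Finset.sum_neg_distrib]
  refine Finset.sum_bij (fun t _ => Equiv.swap x y t) (fun t ht => (swap_mem_iff hxS hyS t).2 ht)
    (fun _ _ _ _ h => (Equiv.swap x y).injective h)
    (fun t ht => ⟨Equiv.swap x y t, (swap_mem_iff hxS hyS t).2 ht, by simp⟩) fun t _ => ?_
  rw [← map_neg, ← hp x hxS y hyS hxy, permute_permute, permute_permute,
    Equiv.mul_swap_eq_swap_mul (Equiv.swap x y) z t, swap_apply_of_mem_of_mem hz hxS hyS]

end Alternation

section Gradings

variable {F G A : Type*} [Field F] [NonUnitalRing A] [Module F A] {𝒜 : G → Submodule F A}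

theorem IsGradedSubspace.le {U N : Submodule F A} (hU : IsGradedSubspace 𝒜 U)
    (h : ∀ g, U ⊓ 𝒜 g ≤ N) : U ≤ N := by
  rw [hU]
  exact iSup_le h

variable [Group G]

theorem IsGrading.isInternal (h𝒜 : IsGrading 𝒜) : DirectSum.IsInternal 𝒜 :=
  DirectSum.isInternal_submodule_of_iSupIndep_of_iSup_eq_top h𝒜.indep h𝒜.iSup_eq_top

/-- The projection onto a homogeneous component. -/
noncomputable def IsGrading.proj (h𝒜 : IsGrading 𝒜) (g : G) : A →ₗ[F] A :=
  letI := h𝒜.isInternal.chooseDecomposition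
  (𝒜 g).subtype ∘ₗ DirectSum.component F G (fun g => 𝒜 g) g ∘ₗ
    (DirectSum.decomposeLinearEquiv 𝒜).toLinearMap

theorem IsGrading.proj_mem (h𝒜 : IsGrading 𝒜) (g : G) (a : A) : h𝒜.proj g a ∈ 𝒜 g :=
  Subtype.mem _

theorem IsGrading.proj_of_mem (h𝒜 : IsGrading 𝒜) {g : G} {a : A} (ha : a ∈ 𝒜 g) :
    h𝒜.proj g a = a :=
  letI := h𝒜.isInternal.chooseDecomposition
  DirectSum.decompose_of_mem_same 𝒜 ha

theorem IsGrading.proj_of_mem_ne (h𝒜 : IsGrading 𝒜) {g k : G} {a : A} (ha : a ∈ 𝒜 k)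
    (hk : k ≠ g) : h𝒜.proj g a = 0 :=
  letI := h𝒜.isInternal.chooseDecomposition
  DirectSum.decompose_of_mem_ne 𝒜 ha hk

theorem IsGrading.isGradedSubspace_top (h𝒜 : IsGrading 𝒜) : IsGradedSubspace 𝒜 ⊤ := by
  simp [IsGradedSubspace, h𝒜.iSup_eq_top]

theorem IsGrading.proj_mem_of_mem_iSup (h𝒜 : IsGrading 𝒜) {N : G → Submodule F A}
    (hN : ∀ g, N g ≤ 𝒜 g) {a : A} (ha : a ∈ ⨆ g, N g) (g : G) : h𝒜.proj g a ∈ N g := by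
  have hle : ⨆ h, N h ≤ (N g).comap (h𝒜.proj g) := iSup_le fun h x hx => by
    rw [Submodule.mem_comap]
    rcases eq_or_ne h g with rfl | hne
    · rwa [h𝒜.proj_of_mem (hN _ hx)]
    · rw [h𝒜.proj_of_mem_ne (hN _ hx) hne]
      exact zero_mem _
  exact hle ha

theorem IsGradedSubspace.proj_mem (h𝒜 : IsGrading 𝒜) {U : Submodule F A}
    (hU : IsGradedSubspace 𝒜 U) {a : A} (ha : a ∈ U) (g : G) : h𝒜.proj g a ∈ U :=
  (h𝒜.proj_mem_of_mem_iSup (fun _ => inf_le_right) (hU ▸ ha : a ∈ ⨆ h, U ⊓ 𝒜 h) g).1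

end Gradings

section GradedSimple

variable {F G A : Type*} [Field F] [Group G] [NonUnitalRing A] [Module F A]
  {𝒜 : G → Submodule F A} {B : Submodule F A}

theorem IsGSimple.mul_mem_inf (h𝒜 : IsGrading 𝒜) (hB : IsGSimple 𝒜 B) {k l : G} {a b : A}
    (ha : a ∈ B ⊓ 𝒜 k) (hb : b ∈ B ⊓ 𝒜 l) : a * b ∈ B ⊓ 𝒜 (k * l) :=
  ⟨hB.mul_mem a ha.1 b hb.1, h𝒜.mul_mem k l a ha.2 b hb.2⟩

variable [IsScalarTower F A A] [SMulCommClass F A A]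

theorem IsGSimple.isGradedIdealOf_iSup (hB : IsGSimple 𝒜 B) {N : G → Submodule F A}
    (hN : ∀ h, N h ≤ B ⊓ 𝒜 h)
    (hl : ∀ k h, ∀ r ∈ B ⊓ 𝒜 k, ∀ x ∈ N h, r * x ∈ N (k * h))
    (hr : ∀ k h, ∀ r ∈ B ⊓ 𝒜 k, ∀ x ∈ N h, x * r ∈ N (h * k)) :
    IsGradedIdealOf 𝒜 B (⨆ h, N h) where
  le := iSup_le fun h => (hN h).trans inf_le_left
  graded := le_antisymm
    (iSup_mono fun h => le_inf (le_iSup N h) ((hN h).trans inf_le_right))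
    (iSup_le fun _ => inf_le_left)
  mul_left b hb a ha := by
    have hle : B ≤ (⨆ h, N h).comap (LinearMap.mulRight F a) := hB.graded.le fun k r hrk => by
      have : ⨆ h, N h ≤ (⨆ h, N h).comap (LinearMap.mulLeft F r) :=
        iSup_le fun h x hx => le_iSup N (k * h) (hl k h r hrk x hx)
      exact this ha
    exact hle hb
  mul_right b hb a ha := by
    have hle : B ≤ (⨆ h, N h).comap (LinearMap.mulLeft F a) := hB.graded.le fun k r hrk => by
      have : ⨆ h, N h ≤ (⨆ h, N h).comap (LinearMap.mulRight F r) :=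
        iSup_le fun h x hx => le_iSup N (h * k) (hr k h r hrk x hx)
      exact this ha
    exact hle hb

theorem IsGSimple.forall_eq_bot_or_forall_eq (h𝒜 : IsGrading 𝒜) (hB : IsGSimple 𝒜 B)
    {N : G → Submodule F A} (hN : ∀ h, N h ≤ B ⊓ 𝒜 h)
    (hl : ∀ k h, ∀ r ∈ B ⊓ 𝒜 k, ∀ x ∈ N h, r * x ∈ N (k * h))
    (hr : ∀ k h, ∀ r ∈ B ⊓ 𝒜 k, ∀ x ∈ N h, x * r ∈ N (h * k)) :
    (∀ h, N h = ⊥) ∨ ∀ h, N h = B ⊓ 𝒜 h := by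
  rcases hB.eq_bot_or_eq _ (hB.isGradedIdealOf_iSup hN hl hr) with h | h
  · exact Or.inl (iSup_eq_bot.1 h)
  · refine Or.inr fun k => le_antisymm (hN k) fun x hx => ?_
    rw [← h𝒜.proj_of_mem hx.2]
    exact h𝒜.proj_mem_of_mem_iSup (fun h => (hN h).trans inf_le_right) (h ▸ hx.1) k

theorem IsGSimple.eq_zero_of_forall_mul_left (h𝒜 : IsGrading 𝒜) (hB : IsGSimple 𝒜 B) {g : G}
    {x : A} (hx : x ∈ B ⊓ 𝒜 g) (h : ∀ r ∈ B, r * x = 0) : x = 0 := by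
  let N : G → Submodule F A := fun h =>
    (B ⊓ 𝒜 h) ⊓ ⨅ r ∈ B, LinearMap.ker (LinearMap.mulLeft F r)
  have hmem : ∀ {h y}, y ∈ N h ↔ y ∈ B ⊓ 𝒜 h ∧ ∀ r ∈ B, r * y = 0 := by simp [N]
  rcases hB.forall_eq_bot_or_forall_eq h𝒜 (N := N) (fun _ => inf_le_left)
    (fun k h t ht y hy => hmem.2 ⟨hB.mul_mem_inf h𝒜 ht (hmem.1 hy).1, fun r hr => by
      rw [← mul_assoc, (hmem.1 hy).2 _ (hB.mul_mem r hr t ht.1)]⟩)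
    (fun k h t ht y hy => hmem.2 ⟨hB.mul_mem_inf h𝒜 (hmem.1 hy).1 ht, fun r hr => by
      rw [← mul_assoc, (hmem.1 hy).2 r hr, zero_mul]⟩) with hN | hN
  · rw [← Submodule.mem_bot F, ← hN g]
    exact hmem.2 ⟨hx, h⟩
  · obtain ⟨a, ha, b, hb, hab⟩ := hB.mul_ne_zero
    have hker : B ≤ LinearMap.ker (LinearMap.mulLeft F a) := hB.graded.le fun k y hy =>
      (hmem.1 (hN k ▸ hy)).2 a ha
    exact (hab (hker hb)).elim

theorem IsGSimple.eq_zero_of_forall_mul_right (h𝒜 : IsGrading 𝒜) (hB : IsGSimple 𝒜 B) {g : G}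
    {x : A} (hx : x ∈ B ⊓ 𝒜 g) (h : ∀ s ∈ B, x * s = 0) : x = 0 := by
  let N : G → Submodule F A := fun h =>
    (B ⊓ 𝒜 h) ⊓ ⨅ s ∈ B, LinearMap.ker (LinearMap.mulRight F s)
  have hmem : ∀ {h y}, y ∈ N h ↔ y ∈ B ⊓ 𝒜 h ∧ ∀ s ∈ B, y * s = 0 := by simp [N]
  rcases hB.forall_eq_bot_or_forall_eq h𝒜 (N := N) (fun _ => inf_le_left)
    (fun k h t ht y hy => hmem.2 ⟨hB.mul_mem_inf h𝒜 ht (hmem.1 hy).1, fun s hs => by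
      rw [mul_assoc, (hmem.1 hy).2 s hs, mul_zero]⟩)
    (fun k h t ht y hy => hmem.2 ⟨hB.mul_mem_inf h𝒜 (hmem.1 hy).1 ht, fun s hs => by
      rw [mul_assoc, (hmem.1 hy).2 _ (hB.mul_mem t ht.1 s hs)]⟩) with hN | hN
  · rw [← Submodule.mem_bot F, ← hN g]
    exact hmem.2 ⟨hx, h⟩
  · obtain ⟨a, ha, b, hb, hab⟩ := hB.mul_ne_zero
    have hker : B ≤ LinearMap.ker (LinearMap.mulRight F b) := hB.graded.le fun k y hy =>
      (hmem.1 (hN k ▸ hy)).2 b hb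
    exact (hab (hker ha)).elim

theorem IsGSimple.eq_zero_of_forall_mul_mul (h𝒜 : IsGrading 𝒜) (hB : IsGSimple 𝒜 B) {g : G}
    {b : A} (hb : b ∈ B ⊓ 𝒜 g)
    (h : ∀ k l, ∀ r ∈ B ⊓ 𝒜 k, ∀ s ∈ B ⊓ 𝒜 l, r * (b * s) = 0) : b = 0 := by
  refine hB.eq_zero_of_forall_mul_right h𝒜 hb ?_
  have hle : B ≤ LinearMap.ker (LinearMap.mulLeft F b) := hB.graded.le fun l s hs => by
    refine hB.eq_zero_of_forall_mul_left h𝒜 (hB.mul_mem_inf h𝒜 hb hs) ?_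
    have hle : B ≤ LinearMap.ker (LinearMap.mulRight F (b * s)) :=
      hB.graded.le fun k r hr => h k l r hr s hs
    exact hle
  exact hle

/-- The span of the operators `y ↦ r * y * s`, with homogeneous `r` and `s` in `B`, which map
the elements of degree `g` to elements of degree `h`. -/
def sandwich (𝒜 : G → Submodule F A) (B : Submodule F A) (g h : G) : Submodule F (A →ₗ[F] A) :=
  Submodule.span F {T | ∃ k l, k * g * l = h ∧ ∃ r ∈ B ⊓ 𝒜 k, ∃ s ∈ B ⊓ 𝒜 l,
    T = LinearMap.mulLeft F r ∘ₗ LinearMap.mulRight F s}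

theorem IsGSimple.apply_mem_of_mem_sandwich (h𝒜 : IsGrading 𝒜) (hB : IsGSimple 𝒜 B) {g h : G}
    {T : A →ₗ[F] A} (hT : T ∈ sandwich 𝒜 B g h) {y : A} (hy : y ∈ B ⊓ 𝒜 g) :
    T y ∈ B ⊓ 𝒜 h := by
  have : sandwich 𝒜 B g h ≤ (B ⊓ 𝒜 h).comap (LinearMap.applyₗ y) := Submodule.span_le.2 <| by
    rintro T ⟨k, l, rfl, r, hr, s, hs, rfl⟩
    rw [mul_assoc]
    exact hB.mul_mem_inf h𝒜 hr (hB.mul_mem_inf h𝒜 hy hs)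
  exact this hT

theorem apply_eq_zero_of_mem_sandwich {g h : G} {T : A →ₗ[F] A} (hT : T ∈ sandwich 𝒜 B g h)
    {y : A} (hy : ∀ s ∈ B, y * s = 0) : T y = 0 := by
  have : sandwich 𝒜 B g h ≤ LinearMap.ker (LinearMap.applyₗ y) := Submodule.span_le.2 <| by
    rintro T ⟨k, l, rfl, r, -, s, hs, rfl⟩
    simp [hy s hs.1]
  exact this hT

theorem IsGSimple.mulLeft_comp_mem_sandwich (h𝒜 : IsGrading 𝒜) (hB : IsGSimple 𝒜 B)
    {g h j : G} {T : A →ₗ[F] A} (hT : T ∈ sandwich 𝒜 B g h) {t : A} (ht : t ∈ B ⊓ 𝒜 j) :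
    LinearMap.mulLeft F t ∘ₗ T ∈ sandwich 𝒜 B g (j * h) := by
  induction hT using Submodule.span_induction with
  | mem T hT =>
    obtain ⟨k, l, rfl, r, hr, s, hs, rfl⟩ := hT
    refine Submodule.subset_span ⟨j * k, l, by simp only [mul_assoc], t * r,
      hB.mul_mem_inf h𝒜 ht hr, s, hs, ?_⟩
    rw [LinearMap.mulLeft_mul, LinearMap.comp_assoc]
  | zero => simp
  | add S T _ _ hS hT => rw [LinearMap.comp_add]; exact add_mem hS hT
  | smul c T _ hT => rw [LinearMap.comp_smul]; exact Submodule.smul_mem _ c hT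

theorem IsGSimple.mulRight_comp_mem_sandwich (h𝒜 : IsGrading 𝒜) (hB : IsGSimple 𝒜 B)
    {g h j : G} {T : A →ₗ[F] A} (hT : T ∈ sandwich 𝒜 B g h) {t : A} (ht : t ∈ B ⊓ 𝒜 j) :
    LinearMap.mulRight F t ∘ₗ T ∈ sandwich 𝒜 B g (h * j) := by
  induction hT using Submodule.span_induction with
  | mem T hT =>
    obtain ⟨k, l, rfl, r, hr, s, hs, rfl⟩ := hT
    refine Submodule.subset_span ⟨k, l * j, by simp only [mul_assoc], r, hr, s * t,
      hB.mul_mem_inf h𝒜 hs ht, ?_⟩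
    ext y
    simp [mul_assoc]
  | zero => simp
  | add S T _ _ hS hT => rw [LinearMap.comp_add]; exact add_mem hS hT
  | smul c T _ hT => rw [LinearMap.comp_smul]; exact Submodule.smul_mem _ c hT

theorem IsGSimple.comp_mem_sandwich (h𝒜 : IsGrading 𝒜) (hB : IsGSimple 𝒜 B) {g h j : G}
    {S T : A →ₗ[F] A} (hS : S ∈ sandwich 𝒜 B h j) (hT : T ∈ sandwich 𝒜 B g h) :
    S ∘ₗ T ∈ sandwich 𝒜 B g j := by
  induction hS using Submodule.span_induction with
  | mem S hS =>
    obtain ⟨k, l, rfl, r, hr, s, hs, rfl⟩ := hS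
    rw [LinearMap.comp_assoc, mul_assoc]
    exact hB.mulLeft_comp_mem_sandwich h𝒜 (hB.mulRight_comp_mem_sandwich h𝒜 hT hs) hr
  | zero => simp
  | add S S' _ _ hS hS' => rw [LinearMap.add_comp]; exact add_mem hS hS'
  | smul c S _ hS => rw [LinearMap.smul_comp]; exact Submodule.smul_mem _ c hS

theorem IsGSimple.exists_mem_sandwich_apply_eq (h𝒜 : IsGrading 𝒜) (hB : IsGSimple 𝒜 B)
    {g h : G} {b c : A} (hb : b ∈ B ⊓ 𝒜 g) (hb0 : b ≠ 0) (hc : c ∈ B ⊓ 𝒜 h) :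
    ∃ T ∈ sandwich 𝒜 B g h, T b = c := by
  rcases hB.forall_eq_bot_or_forall_eq h𝒜
    (N := fun h => (sandwich 𝒜 B g h).map (LinearMap.applyₗ b))
    (fun h => Submodule.map_le_iff_le_comap.2 fun T hT => hB.apply_mem_of_mem_sandwich h𝒜 hT hb)
    (fun k h r hr => by
      rintro _ ⟨T, hT, rfl⟩
      exact ⟨_, hB.mulLeft_comp_mem_sandwich h𝒜 hT hr, rfl⟩)
    (fun k h r hr => by
      rintro _ ⟨T, hT, rfl⟩
      exact ⟨_, hB.mulRight_comp_mem_sandwich h𝒜 hT hr, rfl⟩) with hN | hN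
  · refine (hb0 (hB.eq_zero_of_forall_mul_mul h𝒜 hb fun k l r hr s hs => ?_)).elim
    rw [← Submodule.mem_bot F, ← hN (k * g * l)]
    exact ⟨_, Submodule.subset_span ⟨k, l, rfl, r, hr, s, hs, rfl⟩, rfl⟩
  · rw [← hN h] at hc
    exact hc

end GradedSimple

section Density

/-- **Burnside's theorem** on algebras of operators without invariant subspaces. -/
theorem subalgebra_eq_top_of_isSimpleModule {F M : Type*} [Field F] [IsAlgClosed F]
    [AddCommGroup M] [Module F M] [FiniteDimensional F M] (R : Subalgebra F (Module.End F M))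
    [IsSimpleModule R M] : R = ⊤ := by
  refine eq_top_iff.2 fun f _ => ?_
  have hschur := IsSimpleModule.algebraMap_end_bijective_of_isAlgClosed F (A := R) (V := M)
  let f' : Module.End (Module.End R M) M :=
    { f with
      map_smul' := fun c x => by
        obtain ⟨c, rfl⟩ := hschur.surjective c
        simp }
  obtain ⟨s, hs⟩ := Module.Finite.fg_top (R := F) (M := M)
  obtain ⟨r, hr⟩ := jacobson_density f' s
  have hfr : f = r := LinearMap.ext_on hs fun m hm => hr m hm
  exact hfr ▸ r.2

variable {F G A : Type*} [Field F] [Group G] [NonUnitalRing A] [Module F A]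
  [IsScalarTower F A A] [SMulCommClass F A A] {𝒜 : G → Submodule F A} {B : Submodule F A}

/-- The endomorphisms of the space `B ⊓ 𝒜 g` induced by the operators `y ↦ r * y * s` of
degree zero, with an identity adjoined. -/
def sandwichAlgebra (𝒜 : G → Submodule F A) (B : Submodule F A) (g : G) :
    Subalgebra F (Module.End F ↥(B ⊓ 𝒜 g)) :=
  Algebra.adjoin F {f | ∃ T ∈ sandwich 𝒜 B g g, ∀ y : ↥(B ⊓ 𝒜 g), (f y : A) = T y}

theorem IsGSimple.isSimpleModule_sandwichAlgebra (h𝒜 : IsGrading 𝒜) (hB : IsGSimple 𝒜 B)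
    {g : G} [Nontrivial ↥(B ⊓ 𝒜 g)] : IsSimpleModule (sandwichAlgebra 𝒜 B g) ↥(B ⊓ 𝒜 g) := by
  refine isSimpleModule_iff_toSpanSingleton_surjective.2 ⟨inferInstance, fun b hb c => ?_⟩
  obtain ⟨T, hT, hTb⟩ := hB.exists_mem_sandwich_apply_eq h𝒜 b.2 (by simpa using hb) c.2
  exact ⟨⟨T.restrict fun y hy => hB.apply_mem_of_mem_sandwich h𝒜 hT hy,
    Algebra.subset_adjoin ⟨T, hT, fun _ => rfl⟩⟩, Subtype.ext hTb⟩

theorem IsGSimple.exists_mem_sandwich_apply_comp (h𝒜 : IsGrading 𝒜) (hB : IsGSimple 𝒜 B)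
    {g h : G} {f : Module.End F ↥(B ⊓ 𝒜 g)} (hf : f ∈ sandwichAlgebra 𝒜 B g)
    {T : A →ₗ[F] A} (hT : T ∈ sandwich 𝒜 B g h) :
    ∃ T' ∈ sandwich 𝒜 B g h, ∀ y : ↥(B ⊓ 𝒜 g), T' y = T (f y) := by
  induction hf using Algebra.adjoin_induction generalizing T with
  | mem f hf =>
    obtain ⟨S, hS, hfS⟩ := hf
    exact ⟨T ∘ₗ S, hB.comp_mem_sandwich h𝒜 hT hS, fun y => by rw [hfS]; rfl⟩
  | algebraMap c => exact ⟨c • T, Submodule.smul_mem _ c hT, fun y => by simp⟩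
  | add f f' _ _ hf hf' =>
    obtain ⟨S, hS, hSf⟩ := hf hT
    obtain ⟨S', hS', hSf'⟩ := hf' hT
    exact ⟨S + S', add_mem hS hS', fun y => by simp [hSf, hSf']⟩
  | mul f f' _ _ hf hf' =>
    obtain ⟨S, hS, hSf⟩ := hf hT
    obtain ⟨S', hS', hSf'⟩ := hf' hS
    exact ⟨S', hS', fun y => by rw [hSf', hSf]; rfl⟩

theorem IsGSimple.exists_mem_sandwich_separating [IsAlgClosed F] [FiniteDimensional F A]
    (h𝒜 : IsGrading 𝒜) (hB : IsGSimple 𝒜 B) {g h : G} {U : Submodule F A} (hU : U ≤ B ⊓ 𝒜 g)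
    {b c : A} (hb : b ∈ B ⊓ 𝒜 g) (hbU : b ∉ U) (hc : c ∈ B ⊓ 𝒜 h) :
    ∃ T ∈ sandwich 𝒜 B g h, T b = c ∧ ∀ u ∈ U, T u = 0 := by
  have hb0 : b ≠ 0 := fun h => hbU (h ▸ zero_mem U)
  have : Nontrivial ↥(B ⊓ 𝒜 g) := ⟨⟨⟨b, hb⟩, 0, fun h => hb0 (congrArg Subtype.val h)⟩⟩
  have := hB.isSimpleModule_sandwichAlgebra h𝒜 (g := g)
  obtain ⟨ξ, hξb, hξU⟩ := Submodule.exists_le_ker_of_notMem hbU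
  have hf : (ξ ∘ₗ (B ⊓ 𝒜 g).subtype).smulRight ((ξ b)⁻¹ • (⟨b, hb⟩ : ↥(B ⊓ 𝒜 g))) ∈
      sandwichAlgebra 𝒜 B g := by
    rw [subalgebra_eq_top_of_isSimpleModule (sandwichAlgebra 𝒜 B g)]
    exact Algebra.mem_top
  obtain ⟨T, hT, hTb⟩ := hB.exists_mem_sandwich_apply_eq h𝒜 hb hb0 hc
  obtain ⟨T', hT', hTf⟩ := hB.exists_mem_sandwich_apply_comp h𝒜 hf hT
  refine ⟨T', hT', ?_, fun u hu => ?_⟩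
  · simpa [hξb, hTb] using hTf ⟨b, hb⟩
  · simpa [LinearMap.mem_ker.1 (hξU hu)] using hTf ⟨u, hU hu⟩

end Density

section TraceNilpotent

open Polynomial

/-- The Fitting idempotent of an integral element, which is divisible by any power of it. -/
theorem exists_isIdempotentElem_aeval {F R : Type*} [Field F] [Ring R] [Algebra F R] {a : R}
    (ha : IsIntegral F a) (m : ℕ) :
    ∃ (u : F[X]) (k : ℕ), IsIdempotentElem (aeval a (X ^ m * u)) ∧
      a ^ k * (1 - aeval a (X ^ m * u)) = 0 := by
  obtain ⟨q, hq, hqX⟩ :=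
    exists_eq_pow_rootMultiplicity_mul_and_not_dvd (minpoly F a) (minpoly.ne_zero ha) 0
  set k := (minpoly F a).rootMultiplicity 0
  rw [C_0, sub_zero] at hq hqX
  have hmin : aeval a (X ^ k * q) = 0 := hq ▸ minpoly.aeval F a
  obtain ⟨u, v, huv⟩ : IsCoprime (X ^ (m + k)) q :=
    (irreducible_X.coprime_iff_not_dvd.2 hqX).pow_left
  have hcompl : 1 - aeval a (X ^ m * (X ^ k * u)) = aeval a (v * q) := by
    rw [← map_one (aeval (R := F) a), ← map_sub, ← huv, ← mul_assoc, ← pow_add, mul_comm _ u,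
      add_sub_cancel_left]
  refine ⟨X ^ k * u, k, ?_, ?_⟩
  · rw [IsIdempotentElem, eq_comm, ← sub_eq_zero, ← mul_one_sub, hcompl, ← map_mul,
      show X ^ m * (X ^ k * u) * (v * q) = X ^ m * u * v * (X ^ k * q) by ring, map_mul, hmin,
      mul_zero]
  · rw [hcompl, ← aeval_X_pow (R := F) a, ← map_mul, mul_left_comm, map_mul, hmin, mul_zero]

theorem isNilpotent_of_trace_pow_eq_zero {F M : Type*} [Field F] [CharZero F] [AddCommGroup M]
    [Module F M] [FiniteDimensional F M] {T : Module.End F M} {m : ℕ}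
    (h : ∀ n, LinearMap.trace F M (T ^ (m + n)) = 0) : IsNilpotent T := by
  have htrace (p : F[X]) : LinearMap.trace F M (aeval T (X ^ m * p)) = 0 := by
    induction p using Polynomial.induction_on' with
    | add p q hp hq => rw [mul_add, map_add, map_add, hp, hq, add_zero]
    | monomial n c =>
      rw [← C_mul_X_pow_eq_monomial, mul_left_comm, ← pow_add, map_mul, aeval_C, aeval_X_pow,
        ← Algebra.smul_def, map_smul, h, smul_zero]
  obtain ⟨u, k, hidem, hk⟩ :=
    exists_isIdempotentElem_aeval (Algebra.IsIntegral.isIntegral (R := F) T) m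
  rw [LinearMap.IsIdempotentElem.eq_zero_of_trace_eq_zero hidem (htrace u), sub_zero,
    mul_one] at hk
  exact ⟨k, hk⟩

end TraceNilpotent

section Jacobson

variable {R : Type*} [Ring R]

theorem list_prod_mem_pow (I : Ideal R) [I.IsTwoSided] (l : List R) :
    l.prod ∈ I ^ l.countP (· ∈ I) := by
  induction l with
  | nil => simp [Submodule.pow_zero]
  | cons a l ih =>
    rw [List.prod_cons]
    by_cases ha : a ∈ I
    · rw [List.countP_cons_of_pos (by simpa using ha), Ideal.IsTwoSided.pow_succ]
      exact Ideal.mul_mem_mul ha ih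
    · rw [List.countP_cons_of_neg (by simpa using ha)]
      exact Ideal.mul_mem_left _ a ih

theorem mem_jacobson_of_forall_isNilpotent_mul {x : R} (h : ∀ y, IsNilpotent (y * x)) :
    x ∈ Ring.jacobson R := by
  rw [← Ideal.jacobson_bot, Ideal.mem_jacobson_iff]
  intro y
  obtain ⟨z, hz⟩ := (h y).isUnit_one_add
  refine ⟨↑z⁻¹, ?_⟩
  rw [mul_assoc, Ideal.mem_bot, sub_eq_zero, ← Units.inv_mul z, hz, mul_add, mul_one, add_comm]

end Jacobson

section MulLeft

variable {F G A : Type*} [Field F] [NonUnitalRing A] [Module F A] [SMulCommClass F A A]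

theorem mulLeft_pow_succ (a : A) (n : ℕ) :
    LinearMap.mulLeft F a ^ (n + 1) = LinearMap.mulLeft F ((LinearMap.mulLeft F a ^ n) a) := by
  induction n with
  | zero => simp
  | succ n ih =>
    calc LinearMap.mulLeft F a ^ (n + 1 + 1)
        = LinearMap.mulLeft F a ∘ₗ LinearMap.mulLeft F ((LinearMap.mulLeft F a ^ n) a) := by
          rw [pow_succ', ih, Module.End.mul_eq_comp]
      _ = LinearMap.mulLeft F ((LinearMap.mulLeft F a ^ (n + 1)) a) := by
          rw [← LinearMap.mulLeft_mul, pow_succ', Module.End.mul_apply, LinearMap.mulLeft_apply]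

variable [FiniteDimensional F A]

theorem trace_mulLeft_mul_comm (a b : A) :
    LinearMap.trace F A (LinearMap.mulLeft F (a * b)) =
      LinearMap.trace F A (LinearMap.mulLeft F (b * a)) := by
  rw [LinearMap.mulLeft_mul, LinearMap.mulLeft_mul]
  exact LinearMap.trace_comp_comm' _ _

theorem IsGrading.trace_mulLeft_eq_zero [Group G] {𝒜 : G → Submodule F A}
    (h𝒜 : IsGrading 𝒜) {g : G} (hg : g ≠ 1) {a : A} (ha : a ∈ 𝒜 g) :
    LinearMap.trace F A (LinearMap.mulLeft F a) = 0 :=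
  LinearMap.trace_eq_zero_of_mapsTo_ne h𝒜.isInternal (fun k => g * k)
    (fun _ h => hg (mul_eq_right.1 h)) fun k x hx => h𝒜.mul_mem g k a ha x hx

end MulLeft

section Radical

variable {F A : Type*} [Field F] [NonUnitalRing A] [Module F A] [IsScalarTower F A A]
  [SMulCommClass F A A]

theorem mem_radical {a : A} :
    a ∈ radical F A ↔ (a : Unitization F A) ∈ Ring.jacobson (Unitization F A) := Iff.rfl

theorem mul_mem_radical {a : A} (ha : a ∈ radical F A) (b : A) : a * b ∈ radical F A := by
  rw [mem_radical, Unitization.inr_mul]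
  exact Ideal.mul_mem_right _ _ (mem_radical.1 ha)

variable (F A) in
theorem exists_jacobson_pow_eq_bot [FiniteDimensional F A] :
    ∃ n, Ring.jacobson (Unitization F A) ^ n = ⊥ := by
  have : Module.Finite F (Unitization F A) :=
    Module.Finite.equiv (Unitization.linearEquiv F F A).symm
  have : IsArtinianRing (Unitization F A) := IsArtinianRing.of_finite F _
  rw [← Ideal.jacobson_bot]
  exact IsArtinianRing.isNilpotent_jacobson_bot

theorem inr_mulLeft_pow_apply (a : A) (n : ℕ) (b : A) :
    (((LinearMap.mulLeft F a ^ n) b : A) : Unitization F A) = (a : Unitization F A) ^ n * b := by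
  induction n with
  | zero => simp
  | succ n ih => rw [pow_succ', Module.End.mul_apply, LinearMap.mulLeft_apply,
      Unitization.inr_mul, ih, pow_succ', mul_assoc]

variable [FiniteDimensional F A]

theorem trace_mulLeft_eq_zero_of_mem_radical {a : A} (ha : a ∈ radical F A) :
    LinearMap.trace F A (LinearMap.mulLeft F a) = 0 := by
  obtain ⟨n, hn⟩ := exists_jacobson_pow_eq_bot F A
  have hpow : (a : Unitization F A) ^ n = 0 := by
    rw [← Ideal.mem_bot, ← hn]
    exact Ideal.pow_mem_pow (mem_radical.1 ha) n
  refine (LinearMap.isNilpotent_trace_of_isNilpotent ⟨n, LinearMap.ext fun b => ?_⟩).eq_zero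
  apply Unitization.inr_injective (R := F)
  rw [inr_mulLeft_pow_apply, hpow, zero_mul, LinearMap.zero_apply, Unitization.inr_zero]

theorem isNilpotent_inr_of_trace [CharZero F] {a : A}
    (h : ∀ b, LinearMap.trace F A (LinearMap.mulLeft F (a * b)) = 0) :
    IsNilpotent (a : Unitization F A) := by
  obtain ⟨n, hn⟩ := isNilpotent_of_trace_pow_eq_zero (T := LinearMap.mulLeft F a) (m := 2)
    fun n => by
      rw [show 2 + n = n + 1 + 1 by ring, mulLeft_pow_succ, pow_succ', Module.End.mul_apply,
        LinearMap.mulLeft_apply, h]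
  refine ⟨n + 1, ?_⟩
  rw [pow_succ, ← inr_mulLeft_pow_apply, hn, LinearMap.zero_apply, Unitization.inr_zero]

theorem mem_radical_iff_trace [CharZero F] {a : A} :
    a ∈ radical F A ↔ ∀ b, LinearMap.trace F A (LinearMap.mulLeft F (a * b)) = 0 := by
  refine ⟨fun ha b => trace_mulLeft_eq_zero_of_mem_radical (mul_mem_radical ha b), fun ha => ?_⟩
  refine mem_jacobson_of_forall_isNilpotent_mul fun y => ?_
  have hy : y * (a : Unitization F A) = ((y.fst • a + y.snd * a : A) : Unitization F A) := by
    ext <;> simp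
  rw [Unitization.inrHom_apply, hy]
  refine isNilpotent_inr_of_trace fun b => ?_
  have hmul : LinearMap.mulLeft F ((y.fst • a + y.snd * a) * b) =
      y.fst • LinearMap.mulLeft F (a * b) + LinearMap.mulLeft F (y.snd * (a * b)) := by
    ext
    simp [add_mul, mul_assoc, smul_mul_assoc]
  rw [hmul, map_add, map_smul, ha, smul_zero, zero_add, trace_mulLeft_mul_comm, mul_assoc, ha]

variable {G : Type*} [Group G] {𝒜 : G → Submodule F A}

theorem IsGrading.trace_mulLeft_proj_mul (h𝒜 : IsGrading 𝒜) (g : G) (a : A) {b : A}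
    (hb : b ∈ 𝒜 g⁻¹) :
    LinearMap.trace F A (LinearMap.mulLeft F (h𝒜.proj g a * b)) =
      LinearMap.trace F A (LinearMap.mulLeft F (a * b)) := by
  let τ : A →ₗ[F] F := LinearMap.trace F A ∘ₗ LinearMap.mul F A ∘ₗ LinearMap.mulRight F b
  have hle : (⊤ : Submodule F A) ≤ LinearMap.eqLocus (τ ∘ₗ h𝒜.proj g) τ := by
    refine h𝒜.isGradedSubspace_top.le fun k x ⟨_, hx⟩ => ?_
    rcases eq_or_ne k g with rfl | hk
    · exact congrArg τ (h𝒜.proj_of_mem hx)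
    · have hx0 : τ x = 0 := h𝒜.trace_mulLeft_eq_zero (mul_inv_eq_one.not.2 hk)
        (h𝒜.mul_mem k g⁻¹ x hx b hb)
      rw [LinearMap.mem_eqLocus, LinearMap.comp_apply, h𝒜.proj_of_mem_ne hx hk, map_zero, hx0]
  exact hle (Submodule.mem_top (x := a))

theorem IsGrading.proj_mem_radical [CharZero F] (h𝒜 : IsGrading 𝒜) {a : A}
    (ha : a ∈ radical F A) (g : G) : h𝒜.proj g a ∈ radical F A := by
  rw [mem_radical_iff_trace] at ha ⊢
  have hle : (⊤ : Submodule F A) ≤ LinearMap.ker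
      (LinearMap.trace F A ∘ₗ LinearMap.mul F A ∘ₗ LinearMap.mulLeft F (h𝒜.proj g a)) := by
    refine h𝒜.isGradedSubspace_top.le fun k b ⟨_, hb⟩ => ?_
    rw [LinearMap.mem_ker]
    rcases eq_or_ne k g⁻¹ with rfl | hk
    · exact (h𝒜.trace_mulLeft_proj_mul g a hb).trans (ha b)
    · exact h𝒜.trace_mulLeft_eq_zero (fun h => hk (eq_inv_of_mul_eq_one_right h))
        (h𝒜.mul_mem g k _ (h𝒜.proj_mem g a) b hb)
  exact fun b => hle (Submodule.mem_top (x := b))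

end Radical

section WedderburnMalcev

variable {F G A : Type*} [Field F] [CharZero F] [Group G] [NonUnitalRing A] [Module F A]
  [IsScalarTower F A A] [SMulCommClass F A A] [FiniteDimensional F A] {𝒜 : G → Submodule F A}

theorem WedderburnMalcev.le_iSup_comp_inf_sup_radical (h𝒜 : IsGrading 𝒜)
    (W : WedderburnMalcev 𝒜) (g : G) : 𝒜 g ≤ (⨆ i, W.comp i ⊓ 𝒜 g) ⊔ radical F A := by
  intro a ha
  obtain ⟨s, hs, r, hr, rfl⟩ := Submodule.mem_sup.1
    (W.isCompl.sup_eq_top ▸ Submodule.mem_top : a ∈ (⨆ i, W.comp i) ⊔ radical F A)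
  rw [← h𝒜.proj_of_mem ha, map_add]
  refine Submodule.add_mem_sup ?_ (h𝒜.proj_mem_radical hr g)
  have hle : ⨆ i, W.comp i ≤ (⨆ i, W.comp i ⊓ 𝒜 g).comap (h𝒜.proj g) := iSup_le fun i x hx =>
    Submodule.mem_iSup_of_mem i ⟨(W.simple i).graded.proj_mem h𝒜 hx g, h𝒜.proj_mem g x⟩
  exact hle hs

theorem WedderburnMalcev.finrank_iSup_comp_inf (h𝒜 : IsGrading 𝒜) (W : WedderburnMalcev 𝒜)
    (g : G) : Module.finrank F ↥(⨆ i, W.comp i ⊓ 𝒜 g) = semisimpleDim 𝒜 g := by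
  have hmap : (𝒜 g).map (radical F A).mkQ = (⨆ i, W.comp i ⊓ 𝒜 g).map (radical F A).mkQ := by
    refine le_antisymm ?_ (Submodule.map_mono (iSup_le fun _ => inf_le_right))
    refine (Submodule.map_mono (W.le_iSup_comp_inf_sup_radical h𝒜 g)).trans ?_
    rw [Submodule.map_sup, Submodule.mkQ_map_self, sup_bot_eq]
  have hinj : Injective ((radical F A).mkQ.domRestrict (⨆ i, W.comp i ⊓ 𝒜 g)) := by
    rw [LinearMap.injective_domRestrict_iff, Submodule.ker_mkQ]
    exact (W.isCompl.disjoint.mono_left (iSup_mono fun _ => inf_le_left))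
  rw [semisimpleDim, hmap, ← LinearMap.range_domRestrict, LinearMap.finrank_range_of_inj hinj]

theorem WedderburnMalcev.exists_basis (h𝒜 : IsGrading 𝒜) (W : WedderburnMalcev 𝒜) (g : G) :
    ∃ S : Finset A, (∀ b ∈ S, ∃ i, b ∈ W.comp i ⊓ 𝒜 g) ∧
      LinearIndepOn F id (S : Set A) ∧ S.card = semisimpleDim 𝒜 g := by
  obtain ⟨s, hs, hspan, hli⟩ :=
    exists_linearIndependent F (⋃ i, ((W.comp i ⊓ 𝒜 g : Submodule F A) : Set A))
  rw [← Submodule.iSup_eq_span] at hspan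
  lift s to Finset A using hli.setFinite
  refine ⟨s, fun b hb => Set.mem_iUnion.1 (hs hb), hli, ?_⟩
  rw [← W.finrank_iSup_comp_inf h𝒜, ← hspan, finrank_span_finset_eq_card hli]

end WedderburnMalcev

section AlternatingInsertion

variable {F G : Type*} [Field F] {p : GPoly F G} {V S : Finset (G × ℕ)} {u y z w : G × ℕ}

/-- The variable `u` is replaced by the monomial `y z w`, and then `z` is made to alternate
with the variables of `S`. This is how a new variable is added to an alternating set. -/
noncomputable def alternatingInsert (u y z w : G × ℕ) (S : Finset (G × ℕ)) (p : GPoly F G) :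
    GPoly F G :=
  alternateWith z S
    (expand u (FreeSemigroup.of y * (FreeSemigroup.of z * FreeSemigroup.of w)) p)

theorem letters_of_mul_of_mul_of (y z w : G × ℕ) :
    letters (FreeSemigroup.of y * (FreeSemigroup.of z * FreeSemigroup.of w)) = [y, z, w] := rfl

theorem IsMultilinearIn.alternatingInsert (hp : IsMultilinearIn V p) (hu : u ∈ V)
    (hS : S ⊆ V.erase u) (hn : [y, z, w].Nodup) (hV : ∀ v ∈ [y, z, w], v ∉ V) :
    IsMultilinearIn (V.erase u ∪ {y, z, w}) (alternatingInsert u y z w S p) := by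
  rw [← letters_of_mul_of_mul_of] at hn hV
  have h := hp.expand hu hn hV
  simp only [letters_of_mul_of_mul_of, List.toFinset_cons, List.toFinset_nil,
    insert_empty_eq] at h
  exact h.alternateWith (by simp) (hS.trans Finset.subset_union_left)

theorem IsSkewIn.alternatingInsert (hV : IsMultilinearIn V p) (hp : IsSkewIn S p) (hu : u ∉ S)
    (hS : ∀ v ∈ [y, z, w], v ∉ S) : IsSkewIn (insert z S) (alternatingInsert u y z w S p) :=
  IsSkewIn.alternateWith
    (hp.expand hV hu (by rwa [letters_of_mul_of_mul_of])) (hS z (by simp))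

theorem IsSkewIn.alternatingInsert_of_disjoint {T : Finset (G × ℕ)} (hV : IsMultilinearIn V p)
    (hp : IsSkewIn T p) (hu : u ∉ T) (hT : ∀ v ∈ [y, z, w], v ∉ T) (hS : Disjoint S T) :
    IsSkewIn T (GradedPI.alternatingInsert u y z w S p) :=
  IsSkewIn.alternateWith_of_disjoint
    (hp.expand hV hu (by rwa [letters_of_mul_of_mul_of])) (hT z (by simp)) hS

theorem evalAt_alternatingInsert {A : Type*} [NonUnitalRing A] [Module F A]
    [IsScalarTower F A A] [SMulCommClass F A A] (hp : IsMultilinearIn V p) (hS : S ⊆ V.erase u)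
    (hn : [y, z, w].Nodup) (hV : ∀ v ∈ [y, z, w], v ∉ V) {φ ψ : G × ℕ → A}
    (hψ : ∀ v ∈ V, ψ v = φ v) :
    evalAt ψ (alternatingInsert u y z w S p) = evalAt (update φ u (ψ y * (ψ z * ψ w))) p -
      ∑ t ∈ S, evalAt (update (update φ t (ψ z)) u (ψ y * (φ t * ψ w))) p := by
  have hne : ∀ v ∈ [y, z, w], ∀ t ∈ V, v ≠ t := fun v hv t ht => (ne_of_mem_of_not_mem ht
    (hV v hv)).symm
  simp only [List.mem_cons, List.not_mem_nil, or_false, forall_eq_or_imp, forall_eq] at hne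
  obtain ⟨hyV, hzV, hwV⟩ := hne
  have hzy : y ≠ z := by rintro rfl; simp at hn
  have hzw : w ≠ z := by rintro rfl; simp at hn
  rw [alternatingInsert, evalAt_alternateWith, evalAt_expand]
  congr 1
  · refine evalAt_congr hp fun v hv => ?_
    rcases eq_or_ne v u with rfl | hvu
    · simp
    · rw [update_of_ne hvu, update_of_ne hvu, hψ v hv]
  refine Finset.sum_congr rfl fun t ht => ?_
  have htV : t ∈ V := Finset.mem_of_mem_erase (hS ht)
  rw [evalAt_expand]
  refine evalAt_congr hp fun v hv => ?_
  rcases eq_or_ne v u with rfl | hvu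
  · simp [Equiv.swap_apply_of_ne_of_ne hzy (hyV t htV), hψ t htV,
      Equiv.swap_apply_of_ne_of_ne hzw (hwV t htV)]
  rw [update_of_ne hvu, update_of_ne hvu]
  rcases eq_or_ne v t with rfl | hvt
  · simp
  · rw [update_of_ne hvt, Equiv.swap_apply_of_ne_of_ne (hzV v hv).symm hvt, hψ v hv]

variable [Group G]

theorem wordDegree_update_of_mul_of_mul_of (hdeg : y.1 * z.1 * w.1 = u.1) (v : G × ℕ) :
    wordDegree (update FreeSemigroup.of u (.of y * (.of z * .of w)) v) = v.1 :=
  wordDegree_update (by rw [map_mul, map_mul, ← mul_assoc]; exact hdeg) v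

theorem HasDegree.alternatingInsert {g : G} (hp : HasDegree p g)
    (hdeg : y.1 * z.1 * w.1 = u.1) (hS : ∀ t ∈ S, t.1 = z.1) :
    HasDegree (alternatingInsert u y z w S p) g :=
  (hp.subst (wordDegree_update_of_mul_of_mul_of hdeg)).alternateWith hS

theorem alternatingInsert_mem_tIdealSpan {f : GPoly F G} (hp : p ∈ tIdealSpan f)
    (hdeg : y.1 * z.1 * w.1 = u.1) (hS : ∀ t ∈ S, t.1 = z.1) :
    alternatingInsert u y z w S p ∈ tIdealSpan f :=
  alternateWith_mem_tIdealSpan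
    (subst_mem_tIdealSpan hp (wordDegree_update_of_mul_of_mul_of hdeg)) hS

end AlternatingInsertion

section NonvanishingInsertion

variable {F G A : Type*} [Field F] [Group G] [NonUnitalRing A] [Module F A]
  [IsScalarTower F A A] [SMulCommClass F A A] {𝒜 : G → Submodule F A} {B : Submodule F A}
  {g h : G} {T : A →ₗ[F] A}

theorem exists_apply_mulLeft_comp_mulRight_ne_zero (hT : T ∈ sandwich 𝒜 B g h) {M : Type*}
    [AddCommGroup M] [Module F M] {Ψ : (A →ₗ[F] A) →ₗ[F] M} (hΨ : Ψ T ≠ 0) :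
    ∃ k l, k * g * l = h ∧ ∃ r ∈ B ⊓ 𝒜 k, ∃ s ∈ B ⊓ 𝒜 l,
      Ψ (LinearMap.mulLeft F r ∘ₗ LinearMap.mulRight F s) ≠ 0 := by
  contrapose! hΨ
  suffices h : sandwich 𝒜 B g h ≤ LinearMap.ker Ψ from h hT
  refine Submodule.span_le.2 ?_
  rintro _ ⟨k, l, hkl, r, hr, s, hs, rfl⟩
  exact hΨ k l hkl r hr s hs

/-- The difference below is the value at `T : x ↦ r * (x * s)` of an expression which is linear
in `T`. At the separating operator `T` only its first term is left, namely `evalAt φ p ≠ 0`. -/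
theorem IsMultilinearIn.exists_evalAt_update_sub_sum_ne_zero {p : GPoly F G}
    {V S : Finset (G × ℕ)} {u : G × ℕ} (hp : IsMultilinearIn V p) (hu : u ∈ V)
    {φ : G × ℕ → A} (hφ : evalAt φ p ≠ 0) {b : A} (hT : T ∈ sandwich 𝒜 B g h)
    (hTb : T b = φ u) (hTS : ∀ t ∈ S, T (φ t) = 0) :
    ∃ k l, k * g * l = h ∧ ∃ r ∈ B ⊓ 𝒜 k, ∃ s ∈ B ⊓ 𝒜 l,
      evalAt (update φ u (r * (b * s))) p -
        ∑ t ∈ S, evalAt (update (update φ t b) u (r * (φ t * s))) p ≠ 0 := by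
  let Λ (ψ : G × ℕ → A) : A →ₗ[F] A := IsLinearMap.mk' _ (hp.isLinearMap_evalAt_update ψ hu)
  let Ψ : (A →ₗ[F] A) →ₗ[F] A :=
    Λ φ ∘ₗ LinearMap.applyₗ b - ∑ t ∈ S, Λ (update φ t b) ∘ₗ LinearMap.applyₗ (φ t)
  have hΨ (U : A →ₗ[F] A) : Ψ U = evalAt (update φ u (U b)) p -
      ∑ t ∈ S, evalAt (update (update φ t b) u (U (φ t))) p := by
    simp [Ψ, Λ]
  have hΨT : Ψ T ≠ 0 := by
    rwa [hΨ, hTb, update_eq_self, Finset.sum_eq_zero, sub_zero]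
    intro t ht
    rw [hTS t ht]
    exact map_zero (Λ (update φ t b))
  obtain ⟨k, l, hkl, r, hr, s, hs, hne⟩ := exists_apply_mulLeft_comp_mulRight_ne_zero hT hΨT
  refine ⟨k, l, hkl, r, hr, s, hs, ?_⟩
  rw [hΨ] at hne
  exact hne

end NonvanishingInsertion

section Freshness

variable {G : Type*}

theorem exists_fresh (V : Finset (G × ℕ)) (k g l : G) :
    ∃ y z w : G × ℕ, y.1 = k ∧ z.1 = g ∧ w.1 = l ∧ [y, z, w].Nodup ∧
      ∀ v ∈ [y, z, w], v ∉ V := by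
  obtain ⟨N, hN⟩ : ∃ N, ∀ v ∈ V, v.2 < N :=
    ⟨V.sup Prod.snd + 1, fun v hv => Nat.lt_succ_of_le (Finset.le_sup (f := Prod.snd) hv)⟩
  refine ⟨(k, N), (g, N + 1), (l, N + 2), rfl, rfl, rfl, by simp, fun v hv hvV => ?_⟩
  have hlt := hN v hvV
  simp only [List.mem_cons, List.not_mem_nil, or_false] at hv
  rcases hv with rfl | rfl | rfl <;> simp at hlt

theorem mem_update_insert {ι α : Type*} [DecidableEq ι] [DecidableEq α] {S : ι → Finset α}
    {e e' : ι} {a x : α} :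
    x ∈ update S e (insert a (S e)) e' ↔ e' = e ∧ x = a ∨ x ∈ S e' := by
  rcases eq_or_ne e' e with rfl | he
  · simp
  · simp [he]

theorem pairwise_disjoint_update_insert {ι α : Type*} [DecidableEq ι] [DecidableEq α]
    {S : ι → Finset α} {e : ι} {a : α} (hS : Pairwise (Disjoint on S))
    (ha : ∀ e', a ∉ S e') :
    Pairwise (Disjoint on update S e (insert a (S e))) := by
  refine fun e₁ e₂ he => Finset.disjoint_left.2 fun x hx₁ hx₂ => ?_
  rcases mem_update_insert.1 hx₁ with ⟨he₁, rfl⟩ | hx₁ <;>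
    rcases mem_update_insert.1 hx₂ with ⟨he₂, hx⟩ | hx₂
  · exact he (he₁.trans he₂.symm)
  · exact ha e₂ hx₂
  · exact ha e₁ (hx ▸ hx₁)
  · exact Finset.disjoint_left.1 (hS he) hx₁ hx₂

end Freshness

section Extension

variable {F G A : Type*} [Field F] [NonUnitalRing A] [Module F A] {𝒜 : G → Submodule F A}

theorem IsAdmissible.update {φ : G × ℕ → A} (hφ : IsAdmissible 𝒜 φ) {x : G × ℕ} {a : A}
    (ha : a ∈ 𝒜 x.1) : IsAdmissible 𝒜 (update φ x a) := by
  intro v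
  rcases eq_or_ne v x with rfl | hv
  · rwa [update_self]
  · rw [update_of_ne hv]
    exact hφ v

theorem IsAdmissible.exists_extension {φ : G × ℕ → A} (hφ : IsAdmissible 𝒜 φ)
    {V : Finset (G × ℕ)} {y z w : G × ℕ} (hn : [y, z, w].Nodup) (hV : ∀ v ∈ [y, z, w], v ∉ V)
    {r b s : A} (hr : r ∈ 𝒜 y.1) (hb : b ∈ 𝒜 z.1) (hs : s ∈ 𝒜 w.1) :
    ∃ ψ, IsAdmissible 𝒜 ψ ∧ (∀ v ∈ V, ψ v = φ v) ∧ ψ y = r ∧ ψ z = b ∧ ψ w = s := by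
  simp only [List.nodup_cons, List.mem_cons, List.not_mem_nil, or_false, not_or] at hn
  simp only [List.mem_cons, List.not_mem_nil, or_false, forall_eq_or_imp, forall_eq] at hV
  refine ⟨_, ((hφ.update hr).update hb).update hs, fun v hv => ?_, ?_, ?_, update_self ..⟩
  · rw [update_of_ne (ne_of_mem_of_not_mem hv hV.2.2),
      update_of_ne (ne_of_mem_of_not_mem hv hV.2.1), update_of_ne (ne_of_mem_of_not_mem hv hV.1)]
  · rw [update_of_ne hn.1.2, update_of_ne hn.1.1, update_self]
  · rw [update_of_ne hn.2.1, update_self]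

end Extension

section SkewRealization

variable {F G A ι κ : Type*} [Field F] [NonUnitalRing A] [Module F A] [IsScalarTower F A A]
  [SMulCommClass F A A]

/-- A multilinear polynomial together with an admissible evaluation at which it does not vanish,
such that for every index `e` the polynomial is skew symmetric in a set `skewSet e` of variables
of degree `deg e`, whose values are precisely the `b` with `(e, b) ∈ E`. Moreover every `C i`
contains the value of a variable `slot i` outside these sets: this variable is the place where
further skew symmetric variables can be inserted. -/
structure SkewRealization (𝒜 : G → Submodule F A) (C : κ → Submodule F A) (deg : ι → G)
    (E : Finset (ι × A)) where
  poly : GPoly F G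
  vars : Finset (G × ℕ)
  val : G × ℕ → A
  skewSet : ι → Finset (G × ℕ)
  slot : κ → G × ℕ
  isMultilinearIn : IsMultilinearIn vars poly
  isAdmissible : IsAdmissible 𝒜 val
  evalAt_ne_zero : evalAt val poly ≠ 0
  slot_mem : ∀ i, slot i ∈ vars
  val_slot_mem : ∀ i, val (slot i) ∈ C i
  slot_notMem : ∀ i e, slot i ∉ skewSet e
  skewSet_subset : ∀ e, skewSet e ⊆ vars
  fst_eq : ∀ e, ∀ t ∈ skewSet e, t.1 = deg e
  disjoint : Pairwise (Disjoint on skewSet)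
  isSkewIn : ∀ e, IsSkewIn (skewSet e) poly
  bijOn : ∀ e, Set.BijOn val (skewSet e) {b | (e, b) ∈ E}

namespace SkewRealization

variable {𝒜 : G → Submodule F A} {C : κ → Submodule F A} {deg : ι → G} {E : Finset (ι × A)}
  (R : SkewRealization 𝒜 C deg E) {e : ι} {i : κ} {b : A}

theorem slot_ne (hC : Pairwise (Disjoint on C)) {j : κ} (hj : j ≠ i) : R.slot j ≠ R.slot i := by
  intro h
  refine R.evalAt_ne_zero (R.isMultilinearIn.evalAt_eq_zero (R.slot_mem i) ?_)
  exact Submodule.disjoint_def.1 (hC hj) _ (h ▸ R.val_slot_mem j) (R.val_slot_mem i)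

theorem skewSet_subset_erase_slot : R.skewSet e ⊆ R.vars.erase (R.slot i) := fun _ ht =>
  Finset.mem_erase.2 ⟨ne_of_mem_of_not_mem ht (R.slot_notMem i e), R.skewSet_subset e ht⟩

theorem card_skewSet : (R.skewSet e).card = Set.ncard {b | (e, b) ∈ E} := by
  rw [← (R.bijOn e).image_eq, (R.bijOn e).injOn.ncard_image, Set.ncard_coe_finset]

theorem isSkewIn_alternatingInsert {y z w : G × ℕ} (hV : ∀ v ∈ [y, z, w], v ∉ R.vars) (e' : ι) :
    IsSkewIn (update R.skewSet e (insert z (R.skewSet e)) e')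
      (alternatingInsert (R.slot i) y z w (R.skewSet e) R.poly) := by
  have hVS : ∀ v ∈ [y, z, w], v ∉ R.skewSet e' := fun v hv h => hV v hv (R.skewSet_subset e' h)
  rcases eq_or_ne e' e with rfl | he
  · rw [update_self]
    exact (R.isSkewIn e').alternatingInsert R.isMultilinearIn (R.slot_notMem i e') hVS
  · rw [update_of_ne he]
    exact (R.isSkewIn e').alternatingInsert_of_disjoint R.isMultilinearIn (R.slot_notMem i e')
      hVS (R.disjoint he.symm)

/-- The realization in which the slot of `C i` is replaced by `y z w`, and `z` is added to the
skew set of `e`; the new slot of `C i` is `y`. -/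
noncomputable def extend (hC : Pairwise (Disjoint on C)) {y z w : G × ℕ}
    (hn : [y, z, w].Nodup) (hV : ∀ v ∈ [y, z, w], v ∉ R.vars) (hz : z.1 = deg e)
    {ψ : G × ℕ → A} (hψ : IsAdmissible 𝒜 ψ) (hψV : ∀ v ∈ R.vars, ψ v = R.val v)
    (hy : ψ y ∈ C i) (hzE : (e, ψ z) ∉ E)
    (hne : evalAt ψ (alternatingInsert (R.slot i) y z w (R.skewSet e) R.poly) ≠ 0) :
    SkewRealization 𝒜 C deg (insert (e, ψ z) E) where
  poly := alternatingInsert (R.slot i) y z w (R.skewSet e) R.poly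
  vars := R.vars.erase (R.slot i) ∪ {y, z, w}
  val := ψ
  skewSet := update R.skewSet e (insert z (R.skewSet e))
  slot := update R.slot i y
  isMultilinearIn :=
    R.isMultilinearIn.alternatingInsert (R.slot_mem i) R.skewSet_subset_erase_slot hn hV
  isAdmissible := hψ
  evalAt_ne_zero := hne
  slot_mem j := by
    rcases eq_or_ne j i with rfl | hj
    · simp
    · simp [hj, R.slot_ne hC hj, R.slot_mem j]
  val_slot_mem j := by
    rcases eq_or_ne j i with rfl | hj
    · rwa [update_self]
    · rw [update_of_ne hj, hψV _ (R.slot_mem j)]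
      exact R.val_slot_mem j
  slot_notMem j e' hmem := by
    rw [mem_update_insert] at hmem
    rcases eq_or_ne j i with rfl | hj
    · rw [update_self] at hmem
      rcases hmem with ⟨-, rfl⟩ | hmem
      · simp at hn
      · exact hV y (by simp) (R.skewSet_subset e' hmem)
    · rw [update_of_ne hj] at hmem
      rcases hmem with ⟨-, rfl⟩ | hmem
      · exact hV _ (by simp) (R.slot_mem j)
      · exact R.slot_notMem j e' hmem
  skewSet_subset e' t ht := by
    rcases mem_update_insert.1 ht with ⟨-, rfl⟩ | ht
    · simp
    · exact Finset.mem_union_left _ (R.skewSet_subset_erase_slot ht)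
  fst_eq e' t ht := by
    rcases mem_update_insert.1 ht with ⟨rfl, rfl⟩ | ht
    · exact hz
    · exact R.fst_eq e' t ht
  disjoint := pairwise_disjoint_update_insert R.disjoint fun e' h =>
    hV z (by simp) (R.skewSet_subset e' h)
  isSkewIn := R.isSkewIn_alternatingInsert hV
  bijOn e' := by
    have hold : Set.BijOn ψ (R.skewSet e') {b | (e', b) ∈ E} :=
      (R.bijOn e').congr fun v hv => (hψV v (R.skewSet_subset e' hv)).symm
    rcases eq_or_ne e' e with rfl | he
    · simpa [Set.insert_def] using hold.insert hzE
    · simpa [he] using hold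

theorem exists_extend [Group G] (hC : Pairwise (Disjoint on C)) (hb : b ∈ 𝒜 (deg e))
    (hbE : (e, b) ∉ E) {T : A →ₗ[F] A} (hT : T ∈ sandwich 𝒜 (C i) (deg e) (R.slot i).1)
    (hTb : T b = R.val (R.slot i)) (hTE : ∀ b', (e, b') ∈ E → T b' = 0) :
    ∃ R' : SkewRealization 𝒜 C deg (insert (e, b) E),
      (∀ f, R.poly ∈ tIdealSpan f → R'.poly ∈ tIdealSpan f) ∧
        ∀ g, HasDegree R.poly g → HasDegree R'.poly g := by
  obtain ⟨k, l, hkl, r, hr, s, hs, hne⟩ :=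
    R.isMultilinearIn.exists_evalAt_update_sub_sum_ne_zero (R.slot_mem i) R.evalAt_ne_zero hT hTb
      fun t ht => hTE _ ((R.bijOn e).mapsTo ht)
  obtain ⟨y, z, w, rfl, hz, rfl, hn, hV⟩ := exists_fresh R.vars k (deg e) l
  obtain ⟨ψ, hψ, hψV, rfl, rfl, rfl⟩ :=
    R.isAdmissible.exists_extension hn hV hr.2 (hz ▸ hb) hs.2
  have hS : ∀ t ∈ R.skewSet e, t.1 = z.1 := fun t ht => (R.fst_eq e t ht).trans hz.symm
  rw [← hz] at hkl
  rw [← evalAt_alternatingInsert R.isMultilinearIn R.skewSet_subset_erase_slot hn hV hψV] at hne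
  exact ⟨R.extend hC hn hV hz hψ hψV hr.1 hbE hne,
    fun _ hf => alternatingInsert_mem_tIdealSpan hf hkl hS,
    fun _ hg => hg.alternatingInsert hkl hS⟩

end SkewRealization

end SkewRealization

section FiniteFamilies

theorem exists_finset_mem_iff {α β : Type*} (ι : Type*) [Finite ι] {S : α → Finset β}
    (hS : {a | (S a).Nonempty}.Finite) :
    ∃ E : Finset ((α × ι) × β), ∀ a j b, ((a, j), b) ∈ E ↔ b ∈ S a := by
  have := Fintype.ofFinite ι
  refine ⟨hS.toFinset.biUnion fun a => ({a} ×ˢ Finset.univ) ×ˢ S a, fun a j b => ?_⟩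
  simpa using fun hb => ⟨b, hb⟩

theorem IsGrading.finite_setOf_nonempty {F G A : Type*} [Field F] [Group G] [NonUnitalRing A]
    [Module F A] [FiniteDimensional F A] {𝒜 : G → Submodule F A} (h𝒜 : IsGrading 𝒜)
    {S : G → Finset A} (hS : ∀ g, ∀ b ∈ S g, b ∈ 𝒜 g)
    (hli : ∀ g, LinearIndepOn F id (S g : Set A)) :
    {g | (S g).Nonempty}.Finite := by
  refine (WellFoundedGT.finite_ne_bot_of_iSupIndep h𝒜.indep).subset ?_
  rintro g ⟨b, hb⟩ hg
  exact (hli g).ne_zero hb ((Submodule.eq_bot_iff _).1 hg b (hS g b hb))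

end FiniteFamilies

section Full

variable {F G A : Type*} [Field F] [IsAlgClosed F] [Group G] [NonUnitalRing A] [Module F A]
  [IsScalarTower F A A] [SMulCommClass F A A] [FiniteDimensional F A] {𝒜 : G → Submodule F A}

theorem WedderburnMalcev.exists_mem_sandwich_separating (h𝒜 : IsGrading 𝒜)
    (W : WedderburnMalcev 𝒜) {g h : G} {S : Finset A} (hS : ∀ b ∈ S, ∃ i, b ∈ W.comp i ⊓ 𝒜 g)
    (hli : LinearIndepOn F id (S : Set A)) {b c : A} (hb : b ∈ S) {i : Fin W.q}
    (hbi : b ∈ W.comp i ⊓ 𝒜 g) (hc : c ∈ W.comp i ⊓ 𝒜 h) :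
    ∃ T ∈ sandwich 𝒜 (W.comp i) g h, T b = c ∧ ∀ b' ∈ S, b' ≠ b → T b' = 0 := by
  set S' : Set A := {b' ∈ (S : Set A) | b' ∈ W.comp i ∧ b' ≠ b}
  have hbS' : b ∉ Submodule.span F S' := fun hmem => by
    have hb' := hli.notMem_span hb
    rw [Set.image_id] at hb'
    refine hb' (Submodule.span_mono (fun u hu => ?_) hmem)
    exact ⟨hu.1, hu.2.2⟩
  have hS'le : Submodule.span F S' ≤ W.comp i ⊓ 𝒜 g := Submodule.span_le.2 fun u hu => by
    obtain ⟨j, hj⟩ := hS u hu.1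
    exact ⟨hu.2.1, hj.2⟩
  obtain ⟨T, hT, hTb, hTS'⟩ :=
    (W.simple i).exists_mem_sandwich_separating h𝒜 hS'le hbi hbS' hc
  refine ⟨T, hT, hTb, fun b' hb' hne => ?_⟩
  by_cases hb'i : b' ∈ W.comp i
  · exact hTS' b' (Submodule.subset_span ⟨hb', hb'i, hne⟩)
  · obtain ⟨j, hj⟩ := hS b' hb'
    have hji : j ≠ i := by rintro rfl; exact hb'i hj.1
    exact apply_eq_zero_of_mem_sandwich hT (W.orthogonal j i hji b' hj.1)

theorem WedderburnMalcev.exists_skewRealization (h𝒜 : IsGrading 𝒜) (W : WedderburnMalcev 𝒜)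
    {S : G → Finset A} (hS : ∀ g, ∀ b ∈ S g, ∃ i, b ∈ W.comp i ⊓ 𝒜 g)
    (hli : ∀ g, LinearIndepOn F id (S g : Set A)) {ι : Type*} {deg : ι → G}
    (R₀ : SkewRealization 𝒜 W.comp deg ∅) (E : Finset (ι × A)) (hE : ∀ u ∈ E, u.2 ∈ S (deg u.1)) :
    ∃ R : SkewRealization 𝒜 W.comp deg E,
      (∀ f, R₀.poly ∈ tIdealSpan f → R.poly ∈ tIdealSpan f) ∧
        ∀ g, HasDegree R₀.poly g → HasDegree R.poly g := by
  induction E using Finset.induction_on with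
  | empty => exact ⟨R₀, fun _ => id, fun _ => id⟩
  | insert u E hu ih =>
    obtain ⟨e, b⟩ := u
    rw [Finset.forall_mem_insert] at hE
    obtain ⟨R, hRspan, hRdeg⟩ := ih hE.2
    obtain ⟨i, hbi⟩ := hS _ b hE.1
    obtain ⟨T, hT, hTb, hTS⟩ := W.exists_mem_sandwich_separating h𝒜 (hS _) (hli _) hE.1 hbi
      ⟨R.val_slot_mem i, R.isAdmissible _⟩
    have hTE : ∀ b', (e, b') ∈ E → T b' = 0 := fun b' hb' =>
      hTS b' (hE.2 _ hb') (by rintro rfl; exact hu hb')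
    obtain ⟨R', hR'span, hR'deg⟩ :=
      R.exists_extend W.indep.pairwiseDisjoint hbi.2 hu hT hTb hTE
    exact ⟨R', fun f hf => hR'span f (hRspan f hf), fun g hg => hR'deg g (hRdeg g hg)⟩

theorem IsFullWith.exists_isFoldAlternating [CharZero F] (h𝒜 : IsGrading 𝒜) {f : GPoly F G}
    (hf : IsFullWith 𝒜 f) (ν : ℕ) :
    ∃ f' ∈ tIdealSpan f, f' ∉ gradedIdentities 𝒜 ∧ IsFoldAlternating ν (semisimpleDim 𝒜) f' ∧
      ∀ g, HasDegree f g → HasDegree f' g := by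
  obtain ⟨W, V, φ, hV, hφ, hne, -, hslot⟩ := hf
  choose slot hslotV hslot using hslot
  choose S hS hli hcard using W.exists_basis h𝒜
  have hSfin : {g | (S g).Nonempty}.Finite :=
    h𝒜.finite_setOf_nonempty (fun g b hb => (hS g b hb).elim fun _ hi => hi.2) hli
  obtain ⟨E, hE⟩ := exists_finset_mem_iff (Fin ν) hSfin
  let R₀ : SkewRealization 𝒜 W.comp (Prod.fst : G × Fin ν → G) ∅ :=
    { poly := f, vars := V, val := φ, skewSet := fun _ => ∅, slot := slot
      isMultilinearIn := hV, isAdmissible := hφ, evalAt_ne_zero := hne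
      slot_mem := hslotV, val_slot_mem := hslot
      slot_notMem := by simp, skewSet_subset := by simp, fst_eq := by simp
      disjoint := fun _ _ _ => Finset.disjoint_empty_left _
      isSkewIn := fun _ _ h => absurd h (Finset.notMem_empty _)
      bijOn := by simp }
  obtain ⟨R, hRspan, hRdeg⟩ := W.exists_skewRealization h𝒜 hS hli R₀ E
    fun ⟨⟨g, j⟩, b⟩ hb => (hE g j b).1 hb
  refine ⟨R.poly, hRspan f (mem_tIdealSpan_self f), fun h => R.evalAt_ne_zero (h _ R.isAdmissible),
    ⟨R.vars, fun g j => R.skewSet (g, j), R.isMultilinearIn, fun g j =>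
      ⟨R.skewSet_subset _, R.fst_eq _, ?_⟩, fun g j j' hj => R.disjoint (by simpa using hj),
      fun g j => (R.isSkewIn _).alternatesIn R.isMultilinearIn⟩, hRdeg⟩
  rw [R.card_skewSet, ← hcard g]
  simp only [hE]
  exact Set.ncard_coe_finset _

end Full

section LinearDependence

variable {F A ι : Type*} [Field F] [AddCommGroup A] [Module F A] [FiniteDimensional F A]

theorem exists_sub_mem_span_image_of_finrank_map_mkQ_lt {U N : Submodule F A} {S : Finset ι}
    {φ : ι → A} (hφ : ∀ x ∈ S, φ x ∈ U) (hcard : Module.finrank F (U.map N.mkQ) < S.card) :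
    ∃ x ∈ S, ∃ r ∈ N, φ x - r ∈ Submodule.span F (φ '' {y ∈ S | y ≠ x}) := by
  have hdep : ¬ LinearIndependent F fun x : S => N.mkQ (φ x) := fun hli => by
    have hrank := finrank_span_eq_card hli
    have hle : Submodule.span F (Set.range fun x : S => N.mkQ (φ x)) ≤ U.map N.mkQ :=
      Submodule.span_le.2 (Set.range_subset_iff.2 fun x => ⟨φ x, hφ x x.2, rfl⟩)
    have := Submodule.finrank_mono hle
    rw [hrank, Fintype.card_coe] at this
    exact this.not_gt hcard
  rw [linearIndependent_iff_notMem_span] at hdep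
  push Not at hdep
  obtain ⟨x, hx⟩ := hdep
  have himage : (fun y : S => N.mkQ (φ y)) '' (Set.univ \ {x}) ⊆
      N.mkQ '' (φ '' {y ∈ S | y ≠ x}) := by
    rintro _ ⟨y, hy, rfl⟩
    exact ⟨φ y, ⟨y, ⟨y.2, fun h => hy.2 (Subtype.ext h)⟩, rfl⟩, rfl⟩
  have hmem := Submodule.span_mono himage hx
  rw [Submodule.span_image] at hmem
  obtain ⟨u, hu, hux⟩ := hmem
  refine ⟨x, x.2, φ x - u, ?_, by rwa [sub_sub_cancel]⟩
  rw [← Submodule.ker_mkQ N, LinearMap.mem_ker, map_sub, hux, sub_self]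

end LinearDependence

section RadicalValues

theorem inr_lift {F G A : Type*} [Field F] [NonUnitalRing A] [Module F A]
    (φ : G × ℕ → A) (w : FreeSemigroup (G × ℕ)) :
    ((FreeSemigroup.lift φ w : A) : Unitization F A) =
      ((letters w).map fun x => (φ x : Unitization F A)).prod := by
  induction w using FreeSemigroup.recOnMul with
  | ih1 x => simp [letters_of]
  | ih2 x w _ ih => simp [letters_mul, letters_of, ih]

variable {F G A : Type*} [Field F] [NonUnitalRing A] [Module F A] [IsScalarTower F A A]
  [SMulCommClass F A A] {p : GPoly F G} {V : Finset (G × ℕ)} {φ : G × ℕ → A}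

theorem IsMultilinearIn.evalAt_eq_zero_of_le_card_radical {n : ℕ}
    (hn : Ring.jacobson (Unitization F A) ^ n = ⊥) (hp : IsMultilinearIn V p)
    (hφ : n ≤ (V.filter fun x => φ x ∈ radical F A).card) : evalAt φ p = 0 := by
  rw [evalAt_eq_sum]
  refine Finset.sum_eq_zero fun w hw => ?_
  suffices h : FreeSemigroup.lift φ w = 0 by rw [h, smul_zero]
  apply Unitization.inr_injective (R := F)
  rw [inr_lift, Unitization.inr_zero, ← Ideal.mem_bot, ← hn]
  refine Ideal.pow_le_pow_right ?_ (list_prod_mem_pow (Ring.jacobson (Unitization F A)) _)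
  rw [List.countP_map, List.countP_eq_length_filter]
  refine hφ.trans ((Finset.card_le_card fun x hx => ?_).trans (List.toFinset_card_le _))
  rw [Finset.mem_filter, ← (hp w hw).2 x] at hx
  rw [List.mem_toFinset, List.mem_filter]
  exact ⟨hx.1, by simpa using mem_radical.1 hx.2⟩

variable [NeZero (2 : F)] [FiniteDimensional F A] {U N : Submodule F A}

/-- Modulo `N` the value of some `x ∈ S` is a linear combination of the values of the other
variables of `S`, and substituting one of these values for `x` gives zero. -/
theorem IsSkewIn.exists_evalAt_update_eq {S : Finset (G × ℕ)} (hV : IsMultilinearIn V p)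
    (hp : IsSkewIn S p) (hS : S ⊆ V) (hφ : ∀ x ∈ S, φ x ∈ U)
    (hcard : Module.finrank F (U.map N.mkQ) < S.card) :
    ∃ x ∈ S, ∃ r ∈ N, evalAt (update φ x r) p = evalAt φ p := by
  obtain ⟨x, hx, r, hr, hspan⟩ := exists_sub_mem_span_image_of_finrank_map_mkQ_lt hφ hcard
  refine ⟨x, hx, r, hr, ?_⟩
  let Λ : A →ₗ[F] A := IsLinearMap.mk' _ (hV.isLinearMap_evalAt_update φ (hS hx))
  have hker : Submodule.span F (φ '' {y ∈ S | y ≠ x}) ≤ LinearMap.ker Λ :=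
    Submodule.span_le.2 <| by
      rintro _ ⟨y, ⟨hy, hyx⟩, rfl⟩
      exact hp.evalAt_eq_zero hx hy hyx.symm (by rw [update_self, update_of_ne hyx])
  have hΛ : Λ (φ x) - Λ r = 0 := by rw [← map_sub]; exact hker hspan
  calc evalAt (update φ x r) p = Λ (φ x) := (sub_eq_zero.1 hΛ).symm
    _ = evalAt φ p := congrArg (evalAt · p) (update_eq_self x φ)

theorem IsMultilinearIn.exists_evalAt_eq {ι : Type*} {S : ι → Finset (G × ℕ)}
    (hV : IsMultilinearIn V p) (hp : ∀ j, IsSkewIn (S j) p) (hS : ∀ j, S j ⊆ V)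
    (hdisj : Pairwise (Disjoint on S)) (hφ : ∀ j, ∀ x ∈ S j, φ x ∈ U)
    (hcard : ∀ j, Module.finrank F (U.map N.mkQ) < (S j).card) (T : Finset ι) :
    ∃ ψ : G × ℕ → A, (∀ j ∈ T, ∃ x ∈ S j, ψ x ∈ N) ∧
      (∀ y, (∀ j ∈ T, y ∉ S j) → ψ y = φ y) ∧ evalAt ψ p = evalAt φ p := by
  induction T using Finset.induction_on with
  | empty => exact ⟨φ, by simp, by simp, rfl⟩
  | insert j T hj ih =>
    obtain ⟨ψ, hψN, hψφ, heval⟩ := ih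
    have hψS : ∀ y ∈ S j, ψ y ∈ U := fun y hy => by
      rw [hψφ y fun j' hj' => Finset.disjoint_left.1 (hdisj (by rintro rfl; exact hj hj')) hy]
      exact hφ j y hy
    obtain ⟨x, hx, r, hr, hxr⟩ := (hp j).exists_evalAt_update_eq hV (hS j) hψS (hcard j)
    refine ⟨update ψ x r, ?_, fun y hy => ?_, hxr.trans heval⟩
    · rw [Finset.forall_mem_insert]
      refine ⟨⟨x, hx, by rwa [update_self]⟩, fun j' hj' => ?_⟩
      obtain ⟨x', hx', hx'N⟩ := hψN j' hj'
      have hne : x' ≠ x := by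
        rintro rfl
        exact Finset.disjoint_left.1 (hdisj (by rintro rfl; exact hj hj')) hx hx'
      exact ⟨x', hx', by rwa [update_of_ne hne]⟩
    · rw [Finset.forall_mem_insert] at hy
      rw [update_of_ne (ne_of_mem_of_not_mem hx hy.1).symm, hψφ y hy.2]

theorem le_semisimpleDim_of_mem_Ind₀ [Group G] {𝒜 : G → Submodule F A} {α : G → ℕ}
    (hα : α ∈ Ind₀ (gradedIdentities 𝒜)) : α ≤ semisimpleDim 𝒜 := by
  by_contra hle
  rw [Pi.le_def] at hle
  push Not at hle
  obtain ⟨g, hg⟩ := hle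
  obtain ⟨n, hn⟩ := exists_jacobson_pow_eq_bot F A
  obtain ⟨p, hp, -, V, S, hV, hS, hdisj, halt⟩ := hα n
  refine hp fun φ hφ => ?_
  obtain ⟨ψ, hψ, -, heval⟩ := hV.exists_evalAt_eq (fun j => (halt g j).isSkewIn)
    (fun j => (hS g j).1) (hdisj g) (fun j x hx => (hS g j).2.1 x hx ▸ hφ x)
    (fun j => hg.trans_eq (hS g j).2.2.symm) Finset.univ
  choose x hxS hx using fun j => hψ j (Finset.mem_univ j)
  have hxinj : Injective x := fun j j' hjj' => by
    by_contra hne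
    exact Finset.disjoint_left.1 (hdisj g j j' hne) (hxS j) (hjj' ▸ hxS j')
  rw [← heval]
  refine hV.evalAt_eq_zero_of_le_card_radical hn ?_
  calc n = (Finset.univ.image x).card := by
        rw [Finset.card_image_of_injective _ hxinj, Finset.card_univ, Fintype.card_fin]
    _ ≤ _ := Finset.card_le_card <| Finset.image_subset_iff.2 fun j _ =>
        Finset.mem_filter.2 ⟨(hS g j).1 (hxS j), hx j⟩

end RadicalValues

section Homogeneous

variable {F G A : Type*} [Field F] [Group G] [NonUnitalRing A] [Module F A]
  [IsScalarTower F A A] [SMulCommClass F A A] {𝒜 : G → Submodule F A}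

/-- The linear combination of the monomials of `G`-degree `g` in `p`. -/
noncomputable def homogeneousPart (g : G) (p : GPoly F G) : GPoly F G :=
  .ofCoeff (p.coeff.filter fun w => wordDegree w = g)

theorem mem_support_homogeneousPart {g : G} {p : GPoly F G} {w : FreeSemigroup (G × ℕ)} :
    w ∈ (homogeneousPart g p).coeff.support ↔ w ∈ p.coeff.support ∧ wordDegree w = g := by
  change w ∈ (p.coeff.filter fun w => wordDegree w = g).support ↔ _
  rw [Finsupp.support_filter, Finset.mem_filter]

theorem sum_homogeneousPart (p : GPoly F G) :
    ∑ g ∈ p.coeff.support.image wordDegree, homogeneousPart g p = p := by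
  apply MonoidAlgebra.coeff_injective
  ext w
  have hcoeff (g : G) :
      (homogeneousPart g p).coeff w = if wordDegree w = g then p.coeff w else 0 :=
    Finsupp.filter_apply _ _ _
  rw [MonoidAlgebra.coeff_sum, Finsupp.finsetSum_apply]
  simp only [hcoeff, Finset.sum_ite_eq, ite_eq_left_iff]
  exact fun h => by_contra fun hw => h
    (Finset.mem_image_of_mem _ (Finsupp.mem_support_iff.2 (Ne.symm hw)))

theorem IsFullWith.exists_homogeneousPart {f : GPoly F G} (hf : IsFullWith 𝒜 f) :
    ∃ g, IsFullWith 𝒜 (homogeneousPart g f) := by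
  obtain ⟨W, V, φ, hV, hφ, hne, hval⟩ := hf
  obtain ⟨g, -, hg⟩ : ∃ g ∈ f.coeff.support.image wordDegree,
      evalAt φ (homogeneousPart g f) ≠ 0 := by
    refine Finset.exists_ne_zero_of_sum_ne_zero ?_
    rwa [← map_sum, sum_homogeneousPart]
  exact ⟨g, W, V, φ, fun w hw => hV w (mem_support_homogeneousPart.1 hw).1, hφ, hg, hval⟩

theorem IsFull.semisimpleDim_mem_Ind₀ [CharZero F] [IsAlgClosed F] [FiniteDimensional F A]
    (h𝒜 : IsGrading 𝒜) (hA : IsFull 𝒜) : semisimpleDim 𝒜 ∈ Ind₀ (gradedIdentities 𝒜) := by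
  intro ν
  obtain ⟨f, hf⟩ := hA
  obtain ⟨g, hg⟩ := hf.exists_homogeneousPart
  obtain ⟨p, -, hp, hpalt, hpdeg⟩ := hg.exists_isFoldAlternating h𝒜 ν
  exact ⟨p, hp, ⟨g, hpdeg g fun w hw => (mem_support_homogeneousPart.1 hw).2⟩, hpalt⟩

theorem E₀_eq_singleton {Γ : Submodule F (GPoly F G)} {d : G → ℕ}
    (hd : IsGreatest (Ind₀ Γ) d) : E₀ Γ = {d} := by
  ext α
  refine ⟨fun ⟨hα, hmax⟩ => (hmax d hd.1 (hd.2 hα)).symm, ?_⟩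
  rintro rfl
  exact ⟨hd.1, fun β hβ hle => le_antisymm (hd.2 hβ) hle⟩

end Homogeneous

end GradedPI

theorem mainTheorem10_general {F G A : Type*} [Field F] [CharZero F] [IsAlgClosed F]
    [Group G] [NonUnitalRing A] [Module F A] [IsScalarTower F A A] [SMulCommClass F A A]
    [FiniteDimensional F A] (𝒜 : G → Submodule F A) (h𝒜 : GradedPI.IsGrading 𝒜) :
    (∀ f : GradedPI.GPoly F G, GradedPI.IsFullWith 𝒜 f → ∀ ν : ℕ,
      ∃ f' ∈ GradedPI.tIdealSpan f, f' ∉ GradedPI.gradedIdentities 𝒜 ∧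
        GradedPI.IsFoldAlternating ν (GradedPI.semisimpleDim 𝒜) f' ∧
        (GradedPI.IsStronglyHomogeneous f → GradedPI.IsStronglyHomogeneous f')) ∧
    (GradedPI.IsFull 𝒜 →
      GradedPI.E₀ (GradedPI.gradedIdentities 𝒜) = {GradedPI.semisimpleDim 𝒜}) := by
  refine ⟨fun f hf ν => ?_, fun hfull => GradedPI.E₀_eq_singleton
    ⟨hfull.semisimpleDim_mem_Ind₀ h𝒜, fun α hα => GradedPI.le_semisimpleDim_of_mem_Ind₀ hα⟩⟩
  obtain ⟨f', hmem, hne, halt, hdeg⟩ := hf.exists_isFoldAlternating h𝒜 ν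
  exact ⟨f', hmem, hne, halt, fun ⟨g, hg⟩ => ⟨g, hdeg g hg⟩⟩

theorem mainTheorem10 {F G A : Type*} [Field F] [CharZero F] [IsAlgClosed F]
    [Group G] [Finite G]
    [NonUnitalRing A] [Module F A] [IsScalarTower F A A] [SMulCommClass F A A]
    [FiniteDimensional F A]
    (𝒜 : G → Submodule F A) (h𝒜 : GradedPI.IsGrading 𝒜)
    (hA : GradedPI.IsSubdirectlyIrreducible 𝒜) :
    (∀ f : GradedPI.GPoly F G, GradedPI.IsFullWith 𝒜 f → ∀ ν : ℕ,
      ∃ f' ∈ GradedPI.tIdealSpan f, f' ∉ GradedPI.gradedIdentities 𝒜 ∧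
        GradedPI.IsFoldAlternating ν (GradedPI.semisimpleDim 𝒜) f' ∧
        (GradedPI.IsStronglyHomogeneous f → GradedPI.IsStronglyHomogeneous f')) ∧
    (GradedPI.IsFull 𝒜 →
      GradedPI.E₀ (GradedPI.gradedIdentities 𝒜) = {GradedPI.semisimpleDim 𝒜}) :=
  mainTheorem10_general 𝒜 h𝒜
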